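/- Let $\kappa>0$, let $s\ge 1$ be an integer, and let $\mathbf k=(k_0,\dots,k_s)$ be integers with $1=k_0<k_1<\dots<k_s=k$ and $k_i\mid k_{i+1}$ for $0\le i<s$. An overlap sequence is a real sequence $\mathbf q$ with $1=q_0>q_1>\dots>q_s>q_{s+1}=0$; put $$Q=Q_{\mathbf k,\mathbf q}=\sum_{i=0}^{s}(q_i-q_{i+1})\,I_{k/k_i}\otimes \mathbf 1_{k_i}\mathbf 1_{k_i}^T\in\mathbb R^{k\times k}.$$ *Critical density.* Let $G\in\mathbb R^{m\times n}$ have independent standard normal entries. The Gaussian symmetric binary perceptron of density $\alpha>0$ and margin $\kappa$ exhibits $ult_s$-OGP if there are a sequence $\mathbf k$ and an overlap sequence $\mathbf q$ as above (of level $s$) and $\varepsilon>0$ such that, whenever $m=m(n)$ with $m/n\to\alpha$, $$\mathbb P_G\Big(\exists X\in\{\pm n^{-1/2}\}^{n\times k}:\ \max_{a,b}|(X^TX-Q)_{ab}|\le\varepsilon,\ \ |(GX)_{ra}|\le\kappa\ \text{ for all } r,a\Big)\longrightarrow 0\qquad(n\to\infty).$$ Let $\alpha_{ult_s}(\kappa)$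 be the infimum of all $\alpha>0$ for which this happens (with $\inf\emptyset=+\infty$). *Probabilistic factor.* Put $c_1=\frac1{1-q_1}$ and, with $S_i=\sum_{j=1}^{i}k_{j-1}c_j$, $c_{i+1}=-S_i^2\big(\frac1{q_i-q_{i+1}}+k_iS_i\big)^{-1}$ for $1\le i\le s$. For $z=(z_1,\dots,z_s)$ let $D=\sum_{i=1}^s\sqrt{-c_{i+1}/c_1}\;z_i$, $E=\sqrt{c_1}\,\kappa$, $$\tilde I_0(z)=-\tfrac12e^{D^2/2}\Big(\mathrm{erf}\tfrac{D-E}{\sqrt2}-\mathrm{erf}\tfrac{D+E}{\sqrt2}\Big),\qquad \tilde I_i(z)=\frac1{\sqrt{2\pi}}\int_{\mathbb R}\tilde I_{i-1}(z)^{k_i/k_{i-1}}e^{-z_i^2/2}\,dz_i\quad(1\le i\le s-1),$$ $$p^{(s)}_{\mathbf q}(\mathbf k)=\frac{1}{c_1^{k/2}\det(Q)^{1/2}}\,\frac1{\sqrt{2\pi}}\int_{\mathbb R}\tilde I_{s-1}(z)^{k_s/k_{s-1}}e^{-z_s^2/2}\,dz_s .$$ *Combinatorial factor.* For $1\le j\le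 k$, the step-$j$ cells are the sign patterns $\tau\in\{+,-\}^j$ with $\tau_1=+$. Consider lengths $a_\tau\ge 0$ of the cells of all steps, subject to the linear constraints $A_{eq}a=b_{eq}$ that consist of the overlap constraints $\sum_{\tau\in\{+,-\}^j,\ \tau_1=+,\ \tau_i=\tau_j}a_\tau=\frac{1+Q_{ij}}2$ for $1\le i<j\le k$ and of the repartition constraints $a_{\tau+}+a_{\tau-}-a_\tau=0$ for every cell $\tau$ of a step $j<k$, and to $\sum a_\tau=1$ over the step-$k$ cells. Let $$h^{(s)}_{\mathbf q}(\mathbf k)=1+\max_a\Big(-\sum_{\tau\text{ step-}k\text{ cell}}a_\tau\log_2a_\tau\Big)$$ be given by the maximum of the entropy of the step-$k$ cells over these lengths ($0\log_2 0=0$). **Theorem.** For every $\kappa>0$, $s\ge1$ and $\mathbf k$ as above: for every overlap sequence $\mathbf q$ the maximum defining $h^{(s)}_{\mathbf q}(\mathbf k)$ is attained, and $p^{(s)}_{\mathbf q}(\mathbf k)\in(0,1)$ is the probability that $k$ centred jointly Gaussian variables with covariance matrix $Q_{\mathbf k,\mathbf q}$ all lie in $[-\kappa,\kappa]$; and $$\alpha_{ult_s}(\kappa)\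 \le\ \inf_{\mathbf q}\left(-\frac{h^{(s)}_{\mathbf q}(\mathbf k)\,\log 2}{\log p^{(s)}_{\mathbf q}(\mathbf k)}\right)=:\bar\alpha_{ult_s}(\kappa;\mathbf k),$$ the infimum being over all overlap sequences $\mathbf q$ of level $s$. -/

import Mathlib

open MeasureTheory ProbabilityTheory Filter Topology

noncomputable section

namespace SBP

/-- An increasing integer sequence `1 = k₀ < k₁ < ⋯ < k_s` of cluster sizes, each dividing the
next one. Only the entries `k 0, …, k s` matter; the number of vectors is `k s`. -/
structure IsClusterSeq (s : ℕ) (k : ℕ → ℕ) : Prop where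
  zero : k 0 = 1
  lt_succ : ∀ i < s, k i < k (i + 1)
  dvd_succ : ∀ i < s, k i ∣ k (i + 1)

/-- A decreasing real sequence `1 = q₀ > q₁ > ⋯ > q_s > q_{s+1} = 0` of overlaps. -/
structure IsOverlapSeq (s : ℕ) (q : ℕ → ℝ) : Prop where
  zero : q 0 = 1
  last : q (s + 1) = 0
  succ_lt : ∀ i ≤ s, q (i + 1) < q i

/-- The block diagonal matrix `I_{K/l} ⊗ (𝟏_l 𝟏_lᵀ)` of size `K`. -/
def blockOnes (K l : ℕ) : Matrix (Fin K) (Fin K) ℝ :=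
  Matrix.of fun a b => if a.val / l = b.val / l then 1 else 0

/-- The `s`-level ultrametric overlap matrix `∑_{i=0}^s (q_i - q_{i+1}) I_{k/k_i} ⊗ (𝟏 𝟏ᵀ)`. -/
def ultMatrix (s : ℕ) (k : ℕ → ℕ) (q : ℕ → ℝ) : Matrix (Fin (k s)) (Fin (k s)) ℝ :=
  ∑ i ∈ Finset.range (s + 1), (q i - q (i + 1)) • blockOnes (k s) (k i)

/-! ### The critical density of the ultrametric overlap gap property -/

/-- The columns of `X` are points of the cube `{-1/√n, 1/√n}ⁿ`. -/
def ColumnsInCube {n K : ℕ} (X : Matrix (Fin n) (Fin K) ℝ) : Prop :=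
  ∀ r a, X r a = 1 / √(n : ℝ) ∨ X r a = -(1 / √(n : ℝ))

/-- The matrices `X` with columns in the cube whose overlap matrix `Xᵀ X` is `Q`, up to an
error of at most `ε` in each entry. -/
def overlapSet (n : ℕ) {K : ℕ} (Q : Matrix (Fin K) (Fin K) ℝ) (ε : ℝ) :
    Set (Matrix (Fin n) (Fin K) ℝ) :=
  {X | ColumnsInCube X ∧ ∀ a b, |(X.transpose * X) a b - Q a b| ≤ ε}

/-- The law of an `m × n` matrix with independent standard normal entries. -/
def gaussianMatrix (m n : ℕ) : Measure (Fin m → Fin n → ℝ) :=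
  Measure.pi fun _ => Measure.pi fun _ => gaussianReal 0 1

/-- The event that some `X` in `overlapSet n Q ε` has all its columns in the solution set
`{x | |G x| ≤ κ 𝟏}` of the symmetric binary perceptron. -/
def tupleEvent (κ : ℝ) (m n : ℕ) {K : ℕ} (Q : Matrix (Fin K) (Fin K) ℝ) (ε : ℝ) :
    Set (Fin m → Fin n → ℝ) :=
  {G | ∃ X ∈ overlapSet n Q ε, ∀ r a, |(Matrix.of G * X) r a| ≤ κ}

/-- The symmetric binary perceptron with margin `κ` and constraint density `α` exhibits the
`s`-level ultrametric overlap gap property: for some cluster sizes and some ultrametric overlap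
matrix `Q`, with high probability no tuple of solutions has overlap matrix `Q`, not even up to
a small fixed tolerance `ε`, in the regime `m / n → α`. -/
def ExhibitsUltOGP (s : ℕ) (κ α : ℝ) : Prop :=
  ∃ (k : ℕ → ℕ) (q : ℕ → ℝ), IsClusterSeq s k ∧ IsOverlapSeq s q ∧
    ∃ ε > 0, ∀ m : ℕ → ℕ, Tendsto (fun n => (m n : ℝ) / n) atTop (𝓝 α) →
      Tendsto (fun n => gaussianMatrix (m n) n (tupleEvent κ (m n) n (ultMatrix s k q) ε))
        atTop (𝓝 0)

/-- The critical constraint density `α_{ult_s}(κ)`: the infimum (in the extended reals, so that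
it is `⊤` for an empty set) of the densities at which the property is exhibited. -/
def alphaUlt (s : ℕ) (κ : ℝ) : EReal :=
  ⨅ (α : ℝ) (_ : 0 < α ∧ ExhibitsUltOGP s κ α), (α : EReal)

/-! ### The probabilistic factor -/

/-- The error function. -/
def erf (x : ℝ) : ℝ := 2 / √Real.pi * ∫ t in (0 : ℝ)..x, Real.exp (-t ^ 2)

/-- The coefficients `c_{w i}`, `i = 1, …, s + 1` (the value at `0` is not used). -/
def cw (k : ℕ → ℕ) (q : ℕ → ℝ) : ℕ → ℝ
  | 0 => 0
  | 1 => 1 / (1 - q 1)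
  | i + 2 =>
    -(∑ j : Fin (i + 1), (k j : ℝ) * cw k q (j + 1)) ^ 2 *
      (1 / (q (i + 1) - q (i + 2)) +
        (k (i + 1) : ℝ) * ∑ j : Fin (i + 1), (k j : ℝ) * cw k q (j + 1))⁻¹
decreasing_by all_goals omega

/-- `D = ∑_{i=1}^s (√(-c_{w(i+1)}) / √c_{w1}) z_i`. -/
def Dval (s : ℕ) (k : ℕ → ℕ) (q : ℕ → ℝ) (z : ℕ → ℝ) : ℝ :=
  ∑ i ∈ Finset.Icc 1 s, √(-cw k q (i + 1)) / √(cw k q 1) * z i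

/-- `E = √c_{w1} κ`. -/
def Eval (κ : ℝ) (k : ℕ → ℕ) (q : ℕ → ℝ) : ℝ := √(cw k q 1) * κ

/-- The nested integrals `Ĩ_i(z)`; the `i`-th one integrates out the variable `z_i`. -/
def Itilde (κ : ℝ) (s : ℕ) (k : ℕ → ℕ) (q : ℕ → ℝ) : ℕ → (ℕ → ℝ) → ℝ
  | 0, z =>
    -(Real.exp (Dval s k q z ^ 2 / 2) *
      (erf (√2 * Dval s k q z / 2 - √2 * Eval κ k q / 2) -
        erf (√2 * Dval s k q z / 2 + √2 * Eval κ k q / 2))) / 2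
  | i + 1, z =>
    1 / √(2 * Real.pi) *
      ∫ t : ℝ, Itilde κ s k q i (Function.update z (i + 1) t) ^ (k (i + 1) / k i) *
        Real.exp (-t ^ 2 / 2)

/-- The probabilistic factor `p^{(s)}_q(k)` as an `s`-fold nested integral. -/
def pFactor (κ : ℝ) (s : ℕ) (k : ℕ → ℕ) (q : ℕ → ℝ) : ℝ :=
  1 / (√(cw k q 1) ^ k s * √(ultMatrix s k q).det) * (1 / √(2 * Real.pi)) *
    ∫ t : ℝ, Itilde κ s k q (s - 1) (Function.update 0 s t) ^ (k s / k (s - 1)) *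
      Real.exp (-t ^ 2 / 2)

/-- The probability that `K` jointly Gaussian centred variables with covariance matrix `Q` all
lie in `[-κ, κ]`. -/
def boxProb (κ : ℝ) {K : ℕ} (Q : Matrix (Fin K) (Fin K) ℝ) : ℝ :=
  (multivariateGaussian (0 : EuclideanSpace ℝ (Fin K)) Q).real {g | ∀ a, |g a| ≤ κ}

/-! ### The combinatorial factor -/

/-- The sign partition intervals. At step `j : Fin K` the `n` coordinates are partitioned
according to the signs of the vectors `0, …, j`, vector `0` being normalised to have only plus
signs; so the intervals of step `j` are the sign patterns that are `true` at `0`, and the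
entries after `j`, which play no role at step `j`, are set to `true`. -/
abbrev Part (K : ℕ) : Type :=
  {v : Fin K × (Fin K → Bool) // ∀ i : Fin K, (i.val = 0 ∨ v.1 < i) → v.2 i = true}

/-- The intervals of the last, finest step; there are `2 ^ (K - 1)` of them. -/
abbrev FinestPart (K : ℕ) : Type := {v : Part K // v.1.1.val + 1 = K}

/-- The intervals of all steps except the last; each is repartitioned at the next step. -/
abbrev CoarsePart (K : ℕ) : Type := {v : Part K // v.1.1.val + 1 < K}

/-- The rows of the constraint system: an overlap row for each pair `i < j` of vectors, and a
repartition row for each interval that is not of the last step. -/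
abbrev Row (K : ℕ) : Type := {p : Fin K × Fin K // p.1 < p.2} ⊕ CoarsePart K

/-- The constraint matrix `A_eq`. The overlap row of `i < j` adds the lengths of the intervals of
step `j` on which the vectors `i` and `j` have the same sign. The repartition row of an interval
`w` of step `j` adds the lengths of the two intervals of step `j + 1` into which `w` is split and
subtracts the length of `w`. -/
def Aeq (K : ℕ) : Matrix (Row K) (Part K) ℝ :=
  Matrix.of fun r v =>
    match r with
    | .inl p => if v.1.1 = p.1.2 ∧ v.1.2 p.1.1 = v.1.2 p.1.2 then 1 else 0
    | .inr w =>
      if v.1.1.val = w.1.1.1.val + 1 ∧ ∀ i ≤ w.1.1.1, v.1.2 i = w.1.1.2 i then 1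
      else if v = w.1 then -1
      else 0

/-- The right-hand side `b_eq`: the vectors `i` and `j` have inner product `Q i j`, so they have
equal signs on a fraction `(1 + Q i j) / 2` of the coordinates. -/
def bEq {K : ℕ} (Q : Matrix (Fin K) (Fin K) ℝ) : Row K → ℝ
  | .inl p => (1 + Q p.1.1 p.1.2) / 2
  | .inr _ => 0

/-- The feasible interval lengths (as fractions of `n`). -/
def feasible {K : ℕ} (Q : Matrix (Fin K) (Fin K) ℝ) : Set (Part K → ℝ) :=
  {a | (∀ v, 0 ≤ a v) ∧ (Aeq K).mulVec a = bEq Q ∧ ∑ v : FinestPart K, a v.1 = 1}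

/-- The entropy, in bits, of the finest partition. -/
def entropy {K : ℕ} (a : Part K → ℝ) : ℝ :=
  -∑ v : FinestPart K, a v.1 * Real.logb 2 (a v.1)

/-- The combinatorial factor `h^{(s)}_q(k)`. -/
def hFactor (s : ℕ) (k : ℕ → ℕ) (q : ℕ → ℝ) : ℝ :=
  1 + sSup (entropy '' feasible (ultMatrix s k q))

/-! ### The bound -/

/-- `\bar α_{ult_s}(κ; k)`, the infimum of `-h log 2 / log p` over the overlap sequences. -/
def alphaUltBar (s : ℕ) (κ : ℝ) (k : ℕ → ℕ) : EReal :=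
  ⨅ (q : ℕ → ℝ) (_ : IsOverlapSeq s q),
    ((-(hFactor s k q * Real.log 2 / Real.log (pFactor κ s k q)) : ℝ) : EReal)

end SBP

end

/-! The bound is a first moment estimate. For a fixed `X` the rows of `GX` are independent centred
Gaussian vectors with covariance `Xᵀ * X`, so all entries lie in `[-κ, κ]` with probability `boxProb
κ (Xᵀ * X) ^ m`. After its first column is normalised, `X` is a word of length `n` over the finest
cells, and its overlaps are affine in the empirical distribution of that word. The method of types
bounds the number of admissible `X` by `2 ^ n` (signs of the first column) times a polynomial times
`2 ^ (n H)`, with `H` a bound on the entropies that the overlap constraints allow. For small `ε`,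
semicontinuity keeps `H` near the maximum of the program and `boxProb` below any number above its
value at `Q` (`exists_entropy_lt`, `exists_boxProb_lt`). The union bound then decays as soon as `h
log 2 + α log p < 0` (`gaussianMatrix_tupleEvent_le`, `tendsto_firstMoment`).

It remains to identify the two factors. A Gaussian vector with ultrametric covariance is a sum of
independent noises along a tree, so its box probability is obtained by integrating from the leaves
to the root (`boxProb_ultMatrix`). Completing the square at each level turns the nested integrals
`Itilde` into this recursion (`Itilde_eq`), and the accumulated constants are exactly those in the
determinant of `Q` (`det_partialSum`). The entropy program is a continuous maximisation over a
compact set, nonempty because a mixture of block-constant uniform signs has overlap matrix `Q`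
(`exists_agreeMass_ultMatrix`). -/

noncomputable section

namespace SBP

open WithLp Matrix

/-! ### Gaussian vectors and semicontinuity of the box probability -/

section Gaussian

variable {ι ι' : Type*} [Fintype ι] [DecidableEq ι] [Fintype ι'] [DecidableEq ι']

/-- Comparison of characteristic functions works for degenerate covariances too, which matters
because `Xᵀ * X` may be singular. -/
theorem map_mulVec_multivariateGaussian {S : Matrix ι ι ℝ} (hS : S.PosSemidef)
    (A : Matrix ι' ι ℝ) :
    (multivariateGaussian (0 : EuclideanSpace ℝ ι) S).map
        (fun x => (toLp 2 (A *ᵥ ofLp x) : EuclideanSpace ℝ ι')) =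
      multivariateGaussian 0 (A * S * Aᵀ) := by
  have hS' : (A * S * Aᵀ).PosSemidef := by
    simpa using hS.mul_mul_conjTranspose_same A
  have hm : Measurable (fun x : EuclideanSpace ℝ ι =>
      (toLp 2 (A *ᵥ ofLp x) : EuclideanSpace ℝ ι')) := by fun_prop
  have : IsProbabilityMeasure ((multivariateGaussian (0 : EuclideanSpace ℝ ι) S).map
        (fun x => (toLp 2 (A *ᵥ ofLp x) : EuclideanSpace ℝ ι'))) :=
    Measure.isProbabilityMeasure_map hm.aemeasurable
  apply Measure.ext_of_charFun
  ext t
  rw [charFun_multivariateGaussian hS', charFun_apply, integral_map hm.aemeasurable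
    (by fun_prop)]
  have h1 : ∀ x : EuclideanSpace ℝ ι,
      inner ℝ (toLp 2 (A *ᵥ ofLp x) : EuclideanSpace ℝ ι') t =
        inner ℝ x (toLp 2 (Aᵀ *ᵥ ofLp t) : EuclideanSpace ℝ ι) := by
    intro x
    rw [EuclideanSpace.inner_eq_star_dotProduct, EuclideanSpace.inner_eq_star_dotProduct]
    simp only [star_trivial]
    rw [dotProduct_mulVec, ← mulVec_transpose]
  simp_rw [h1]
  rw [← charFun_apply, charFun_multivariateGaussian hS]
  congr 3
  · simp
  · congr 1
    rw [← mulVec_mulVec, ← mulVec_mulVec, dotProduct_mulVec _ A, ← mulVec_transpose]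

theorem map_mulVec_pi_gaussianReal (A : Matrix ι' ι ℝ) :
    (Measure.pi fun _ : ι => gaussianReal 0 1).map
        (fun x => (toLp 2 (A *ᵥ x) : EuclideanSpace ℝ ι')) =
      multivariateGaussian 0 (A * Aᵀ) := by
  have h := map_mulVec_multivariateGaussian (PosSemidef.one (n := ι) (R := ℝ)) A
  rw [multivariateGaussian_zero_one, ← map_pi_eq_stdGaussian, Measure.map_map
    (by fun_prop) (by fun_prop)] at h
  simpa [Function.comp_def] using h

theorem multivariateGaussian_conv {S T : Matrix ι ι ℝ} (hS : S.PosSemidef) (hT : T.PosSemidef) :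
    multivariateGaussian (0 : EuclideanSpace ℝ ι) S ∗ multivariateGaussian 0 T =
      multivariateGaussian 0 (S + T) := by
  apply Measure.ext_of_charFun
  ext t
  rw [charFun_conv, charFun_multivariateGaussian hS, charFun_multivariateGaussian hT,
    charFun_multivariateGaussian (hS.add hT), ← Complex.exp_add]
  congr 1
  simp only [add_mulVec, dotProduct_add, Complex.ofReal_add]
  simp
  ring

/-- Characteristic functions converge, hence the laws converge weakly. The box is closed, so the
portmanteau theorem gives the upper bound, which is the only direction needed. -/
theorem eventually_boxProb_lt {K : ℕ} (κ : ℝ) {Q : Matrix (Fin K) (Fin K) ℝ} (hQ : Q.PosSemidef)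
    {R : ℕ → Matrix (Fin K) (Fin K) ℝ} (hR : ∀ n, (R n).PosSemidef)
    (hlim : Tendsto R atTop (𝓝 Q)) {p : ℝ} (hp : boxProb κ Q < p) :
    ∀ᶠ n in atTop, boxProb κ (R n) < p := by
  let μ : ℕ → ProbabilityMeasure (EuclideanSpace ℝ (Fin K)) := fun n =>
    ⟨multivariateGaussian 0 (R n), inferInstance⟩
  let μ₀ : ProbabilityMeasure (EuclideanSpace ℝ (Fin K)) :=
    ⟨multivariateGaussian 0 Q, inferInstance⟩
  have hμ : Tendsto μ atTop (𝓝 μ₀) := by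
    apply ProbabilityMeasure.tendsto_of_tendsto_charFun
    intro t
    simp only [μ, μ₀, ProbabilityMeasure.coe_mk]
    simp_rw [charFun_multivariateGaussian (hR _), charFun_multivariateGaussian hQ]
    refine (Complex.continuous_exp.tendsto _).comp (tendsto_const_nhds.sub ?_)
    refine Tendsto.div_const ((Complex.continuous_ofReal.tendsto _).comp ?_) _
    have hc : Continuous fun M : Matrix (Fin K) (Fin K) ℝ => t.ofLp ⬝ᵥ M *ᵥ t.ofLp := by
      fun_prop
    exact (hc.tendsto Q).comp hlim
  have hF : IsClosed {g : EuclideanSpace ℝ (Fin K) | ∀ a, |g a| ≤ κ} := by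
    simp only [Set.ofPred_forall]
    exact isClosed_iInter fun a => isClosed_le (by fun_prop) continuous_const
  have h := ProbabilityMeasure.limsup_measure_closed_le_of_tendsto hμ hF
  have hp0 : 0 < p := measureReal_nonneg.trans_lt hp
  have h2 : (μ₀ : Measure (EuclideanSpace ℝ (Fin K))) {g | ∀ a, |g a| ≤ κ} < ENNReal.ofReal p := by
    rwa [ENNReal.lt_ofReal_iff_toReal_lt (measure_ne_top _ _)]
  filter_upwards [eventually_lt_of_limsup_lt (h.trans_lt h2)] with n hn
  rwa [ENNReal.lt_ofReal_iff_toReal_lt (measure_ne_top _ _)] at hn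

theorem exists_boxProb_lt {K : ℕ} (κ : ℝ) {Q : Matrix (Fin K) (Fin K) ℝ} (hQ : Q.PosSemidef)
    {p : ℝ} (hp : boxProb κ Q < p) :
    ∃ ε > 0, ∀ R : Matrix (Fin K) (Fin K) ℝ, R.PosSemidef → (∀ a b, |R a b - Q a b| ≤ ε) →
      boxProb κ R < p := by
  by_contra! hcon
  choose R hR hRQ hRp using fun n : ℕ => hcon (1 / ((n : ℝ) + 1)) (by positivity)
  have hlim : Tendsto R atTop (𝓝 Q) := by
    refine tendsto_pi_nhds.2 fun a => tendsto_pi_nhds.2 fun b => ?_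
    rw [tendsto_iff_dist_tendsto_zero]
    exact squeeze_zero (fun _ => dist_nonneg) (fun n => hRQ n a b)
      tendsto_one_div_add_atTop_nhds_zero_nat
  obtain ⟨n, hn⟩ := (eventually_boxProb_lt κ hQ hR hlim hp).exists
  exact (hRp n).not_gt hn

theorem boxProb_transpose_mul_self (κ : ℝ) {n K : ℕ} (X : Matrix (Fin n) (Fin K) ℝ) :
    (Measure.pi fun _ : Fin n => gaussianReal 0 1).real {g | ∀ a, |(g ᵥ* X) a| ≤ κ} =
      boxProb κ (Xᵀ * X) := by
  have hm : MeasurableSet {g : EuclideanSpace ℝ (Fin K) | ∀ a, |g a| ≤ κ} := by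
    simp only [Set.ofPred_forall]
    exact MeasurableSet.iInter fun a => measurableSet_le (by fun_prop) measurable_const
  have h := map_mulVec_pi_gaussianReal Xᵀ
  rw [transpose_transpose] at h
  rw [boxProb, ← h, map_measureReal_apply (by fun_prop) hm]
  simp [mulVec_transpose]

theorem gaussianMatrix_forall_abs_le (κ : ℝ) {m n K : ℕ} (X : Matrix (Fin n) (Fin K) ℝ) :
    gaussianMatrix m n {G | ∀ r a, |(Matrix.of G * X) r a| ≤ κ} =
      ENNReal.ofReal (boxProb κ (Xᵀ * X) ^ m) := by
  have h : {G : Fin m → Fin n → ℝ | ∀ r a, |(Matrix.of G * X) r a| ≤ κ} =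
      Set.univ.pi fun _ => {g | ∀ a, |(g ᵥ* X) a| ≤ κ} := by
    ext G
    simp only [Set.mem_ofPred_eq, Set.mem_pi, Set.mem_univ, true_imp_iff]
    rfl
  rw [h, gaussianMatrix, Measure.pi_pi, Finset.prod_const, Finset.card_univ, Fintype.card_fin,
    ← boxProb_transpose_mul_self, ENNReal.ofReal_pow measureReal_nonneg, ofReal_measureReal]

end Gaussian

/-! ### Averaging over independent Gaussian noise -/

section Smoothing

/-- The average of `f` over a Gaussian perturbation of standard deviation `σ`. -/
def gaussSmooth (σ : ℝ) (f : ℝ → ℝ) (u : ℝ) : ℝ := ∫ t, f (u + σ * t) ∂gaussianReal 0 1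

theorem measurable_gaussSmooth (σ : ℝ) {f : ℝ → ℝ} (hf : Measurable f) :
    Measurable (gaussSmooth σ f) := by
  have h : StronglyMeasurable (Function.uncurry fun u t : ℝ => f (u + σ * t)) :=
    (by unfold Function.uncurry; fun_prop : Measurable _).stronglyMeasurable
  exact h.integral_prod_right.measurable

theorem integrable_of_mem_Icc {α : Type*} [MeasurableSpace α] {μ : Measure α} [IsFiniteMeasure μ]
    {f : α → ℝ} (hf : Measurable f) (hI : ∀ x, f x ∈ Set.Icc (0 : ℝ) 1) : Integrable f μ :=
  Integrable.of_bound hf.aestronglyMeasurable 1 <| ae_of_all _ fun x => by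
    rw [Real.norm_of_nonneg (hI x).1]; exact (hI x).2

theorem gaussSmooth_mem_Icc (σ : ℝ) {f : ℝ → ℝ} (hf : Measurable f)
    (hI : ∀ x, f x ∈ Set.Icc (0 : ℝ) 1) (u : ℝ) : gaussSmooth σ f u ∈ Set.Icc (0 : ℝ) 1 := by
  refine ⟨integral_nonneg fun t => (hI _).1, ?_⟩
  have h := integral_mono (μ := gaussianReal 0 1)
    (integrable_of_mem_Icc (f := fun t => f (u + σ * t)) (by fun_prop) fun t => hI _)
    (integrable_const (1 : ℝ)) fun t => (hI _).2
  simpa [gaussSmooth] using h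

theorem gaussSmooth_mem_Ioo (σ : ℝ) {f : ℝ → ℝ} (hf : Measurable f)
    (hI : ∀ x, f x ∈ Set.Ioo (0 : ℝ) 1) (u : ℝ) : gaussSmooth σ f u ∈ Set.Ioo (0 : ℝ) 1 := by
  have hint := integrable_of_mem_Icc (μ := gaussianReal 0 1) (f := fun t => f (u + σ * t))
    (by fun_prop) fun t => Set.Ioo_subset_Icc_self (hI _)
  constructor
  · refine (integral_pos_iff_support_of_nonneg (fun t => (hI _).1.le) hint).2 ?_
    rw [show Function.support (fun t => f (u + σ * t)) = Set.univ from
      Set.eq_univ_of_forall fun t => (hI _).1.ne']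
    simp
  · have h : 0 < ∫ t, (1 - f (u + σ * t)) ∂gaussianReal 0 1 := by
      refine (integral_pos_iff_support_of_nonneg (fun t => sub_nonneg.2 (hI _).2.le)
        ((integrable_const _).sub hint)).2 ?_
      rw [show Function.support (fun t => 1 - f (u + σ * t)) = Set.univ from
        Set.eq_univ_of_forall fun t => (sub_pos.2 (hI _).2).ne']
      simp
    rw [integral_sub (integrable_const _) hint] at h
    simpa [gaussSmooth] using h

theorem posSemidef_smul_one {ι : Type*} [Fintype ι] [DecidableEq ι] {v : ℝ} (hv : 0 ≤ v) :
    (v • (1 : Matrix ι ι ℝ)).PosSemidef :=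
  PosSemidef.one.smul hv

/-- Integrating out independent noise of variance `σ ^ 2` that is added to a Gaussian vector whose
coordinates are repeated along `π`, when the fibres of `π` have `r` elements. -/
theorem integral_prod_multivariateGaussian_submatrix {ι ι' : Type*} [Fintype ι] [DecidableEq ι]
    [Fintype ι'] [DecidableEq ι'] {S : Matrix ι' ι' ℝ} (hS : S.PosSemidef) (π : ι → ι') {r : ℕ}
    (hπ : ∀ c, (Finset.univ.filter fun b => π b = c).card = r) (σ : ℝ)
    {f : ℝ → ℝ} (hf : Measurable f) (hI : ∀ x, f x ∈ Set.Icc (0 : ℝ) 1) :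
    ∫ y, ∏ b, f (y b) ∂multivariateGaussian (0 : EuclideanSpace ℝ ι)
        (S.submatrix π π + σ ^ 2 • (1 : Matrix ι ι ℝ)) =
      ∫ w, ∏ c, gaussSmooth σ f (w c) ^ r ∂multivariateGaussian (0 : EuclideanSpace ℝ ι') S := by
  have hI' : ∀ y : EuclideanSpace ℝ ι, ∏ b, f (y b) ∈ Set.Icc (0 : ℝ) 1 := fun y =>
    ⟨Finset.prod_nonneg fun b _ => (hI _).1,
      Finset.prod_le_one (fun b _ => (hI _).1) fun b _ => (hI _).2⟩
  have hmeas : Measurable fun y : EuclideanSpace ℝ ι => ∏ b, f (y b) := by fun_prop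
  let A : Matrix ι ι' ℝ := Matrix.of fun b c => if π b = c then 1 else 0
  have hA : S.submatrix π π = A * S * Aᵀ := by
    ext b b'
    simp [A, Matrix.mul_apply]
  have hAv : ∀ w : EuclideanSpace ℝ ι', ∀ b, (A *ᵥ ofLp w) b = w (π b) := by
    intro w b
    simp [A, Matrix.mulVec, dotProduct]
  have hn : σ ^ 2 • (1 : Matrix ι ι ℝ) = (σ • (1 : Matrix ι ι ℝ)) * (σ • 1)ᵀ := by
    simp [pow_two, smul_smul]
  -- The vector is `A w` plus independent noise. Given `w`, the noise coordinates are independent,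
  -- so the expectation of the product factors, and equal factors are grouped by the fibres of `π`.
  rw [← multivariateGaussian_conv (hS.submatrix π) (posSemidef_smul_one (sq_nonneg σ)),
    integral_conv (integrable_of_mem_Icc hmeas hI'), hA,
    ← map_mulVec_multivariateGaussian hS A]
  rw [integral_map (by fun_prop) ?_]
  · congr 1
    ext w
    rw [hn, ← map_mulVec_pi_gaussianReal, integral_map (by fun_prop)
      (by fun_prop : Measurable _).aestronglyMeasurable]
    simp only [PiLp.add_apply, hAv, smul_mulVec, one_mulVec, Pi.smul_apply, smul_eq_mul]
    rw [integral_fintype_prod_eq_prod (f := fun b t => f (w (π b) + σ * t))]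
    change ∏ b, gaussSmooth σ f (w (π b)) = _
    rw [← Finset.prod_fiberwise' (g := π) (f := fun c => gaussSmooth σ f (w c))]
    simp [Finset.prod_const, hπ]
  · refine (StronglyMeasurable.integral_prod_right
      (f := fun x y : EuclideanSpace ℝ ι => ∏ b, f ((x + y) b)) ?_).aestronglyMeasurable
    exact (by unfold Function.uncurry; fun_prop : Measurable _).stronglyMeasurable

end Smoothing

/-! ### The box probability as a recursion along the cluster tree -/

section Cluster

variable {s : ℕ} {k : ℕ → ℕ} {q : ℕ → ℝ}

theorem IsClusterSeq.pos (hk : IsClusterSeq s k) : ∀ {i : ℕ}, i ≤ s → 0 < k i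
  | 0, _ => by simp [hk.zero]
  | i + 1, h => (Nat.zero_le _).trans_lt (hk.lt_succ i h)

theorem IsClusterSeq.dvd (hk : IsClusterSeq s k) {i j : ℕ} (hij : i ≤ j) (hj : j ≤ s) :
    k i ∣ k j := by
  induction j, hij using Nat.le_induction with
  | base => exact dvd_rfl
  | succ j hij ih => exact (ih (by omega)).trans (hk.dvd_succ j hj)

theorem IsOverlapSeq.sub_pos (hq : IsOverlapSeq s q) {i : ℕ} (hi : i ≤ s) :
    0 < q i - q (i + 1) :=
  _root_.sub_pos.2 (hq.succ_lt i hi)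

theorem posSemidef_blockOnes (K l : ℕ) : (blockOnes K l).PosSemidef := by
  -- A square incidence matrix, with zero columns for unused block indices, makes divisibility of
  -- `K` by `l` unnecessary.
  let U : Matrix (Fin K) (Fin K) ℝ := Matrix.of fun a b => if a.val / l = b.val then 1 else 0
  have h : blockOnes K l = U * Uᴴ := by
    ext a b
    have ha : a.val / l < K := (Nat.div_le_self _ _).trans_lt a.2
    simp only [blockOnes, U, of_apply, mul_apply, conjTranspose_apply, star_trivial, mul_ite,
      mul_one, mul_zero]
    rw [Finset.sum_eq_single_of_mem (⟨a.val / l, ha⟩ : Fin K) (Finset.mem_univ _)]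
    · simp [eq_comm]
    · intro c _ hc
      have : ¬ a.val / l = c.val := fun h => hc (Fin.ext h.symm)
      simp [this]
  rw [h]
  exact posSemidef_self_mul_conjTranspose U

theorem blockOnes_one (K : ℕ) : blockOnes K 1 = 1 := by
  ext a b
  simp [blockOnes, Matrix.one_apply, Fin.ext_iff]

/-- The covariance matrix of one representative of each of the `N` blocks of level `i`, without
the contributions of the levels below `i`. -/
def levelCov (s : ℕ) (k : ℕ → ℕ) (q : ℕ → ℝ) (N i : ℕ) : Matrix (Fin N) (Fin N) ℝ :=
  ∑ j ∈ Finset.Ico i (s + 1), (q j - q (j + 1)) • blockOnes N (k j / k i)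

theorem posSemidef_levelCov (hq : IsOverlapSeq s q) (N i : ℕ) :
    (levelCov s k q N i).PosSemidef :=
  posSemidef_sum _ fun j hj => (posSemidef_blockOnes _ _).smul
    (hq.sub_pos (by simp at hj; omega)).le

theorem levelCov_zero (hk : IsClusterSeq s k) : levelCov s k q (k s) 0 = ultMatrix s k q := by
  simp [levelCov, ultMatrix, hk.zero]

theorem posSemidef_ultMatrix (hk : IsClusterSeq s k) (hq : IsOverlapSeq s q) :
    (ultMatrix s k q).PosSemidef :=
  levelCov_zero hk (q := q) ▸ posSemidef_levelCov hq _ _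

theorem card_filter_div_eq {M r N : ℕ} (hr : 0 < r) (hN : N = M * r) (π : Fin N → Fin M)
    (hπ : ∀ b, (π b).val = b.val / r) (c : Fin M) :
    (Finset.univ.filter fun b => π b = c).card = r := by
  subst hN
  have h : (Finset.univ.filter fun b => π b = c).map Fin.valEmbedding =
      Finset.Ico (c.val * r) (c.val * r + r) := by
    ext x
    simp only [Finset.mem_map, Finset.mem_filter, Finset.mem_univ, true_and, Fin.ext_iff, hπ,
      Fin.valEmbedding_apply, Finset.mem_Ico]
    constructor
    · rintro ⟨b, hb, rfl⟩
      rw [Nat.div_eq_iff hr] at hb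
      omega
    · rintro ⟨h1, h2⟩
      have h3 : (c.val + 1) * r ≤ M * r := Nat.mul_le_mul_right _ c.2
      refine ⟨⟨x, by rw [add_mul] at h3; omega⟩, ?_, rfl⟩
      rw [Nat.div_eq_iff hr]
      dsimp only
      omega
  rw [← Finset.card_map Fin.valEmbedding, h]
  simp

/-- The probability that the Gaussian variables of one block of level `i` lie in `[-κ, κ]`, given
that the contributions of the levels above `i` add up to `u`. -/
def levelProb (κ : ℝ) (k : ℕ → ℕ) (q : ℕ → ℝ) : ℕ → ℝ → ℝ
  | 0 => gaussSmooth √(q 0 - q 1) (Set.indicator (Set.Icc (-κ) κ) 1)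
  | i + 1 => gaussSmooth √(q (i + 1) - q (i + 2)) fun u => levelProb κ k q i u ^ (k (i + 1) / k i)

/-- The function whose Gaussian average is `levelProb`. -/
def preLevelProb (κ : ℝ) (k : ℕ → ℕ) (q : ℕ → ℝ) : ℕ → ℝ → ℝ
  | 0 => Set.indicator (Set.Icc (-κ) κ) 1
  | i + 1 => fun u => levelProb κ k q i u ^ (k (i + 1) / k i)

theorem levelProb_eq (κ : ℝ) (k : ℕ → ℕ) (q : ℕ → ℝ) (i : ℕ) :
    levelProb κ k q i = gaussSmooth √(q i - q (i + 1)) (preLevelProb κ k q i) := by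
  cases i <;> rfl

theorem measurable_preLevelProb (κ : ℝ) (k : ℕ → ℕ) (q : ℕ → ℝ) (i : ℕ) :
    Measurable (preLevelProb κ k q i) := by
  induction i with
  | zero => exact measurable_one.indicator measurableSet_Icc
  | succ i ih =>
    have : Measurable (levelProb κ k q i) := levelProb_eq κ k q i ▸ measurable_gaussSmooth _ ih
    exact this.pow_const _

theorem measurable_levelProb (κ : ℝ) (k : ℕ → ℕ) (q : ℕ → ℝ) (i : ℕ) :
    Measurable (levelProb κ k q i) :=
  levelProb_eq κ k q i ▸ measurable_gaussSmooth _ (measurable_preLevelProb κ k q i)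

theorem preLevelProb_mem_Icc (κ : ℝ) (k : ℕ → ℕ) (q : ℕ → ℝ) (i : ℕ) (u : ℝ) :
    preLevelProb κ k q i u ∈ Set.Icc (0 : ℝ) 1 := by
  induction i generalizing u with
  | zero =>
    simp only [preLevelProb, Set.indicator_apply, Pi.one_apply]
    split_ifs <;> simp
  | succ i ih =>
    have h := gaussSmooth_mem_Icc √(q i - q (i + 1)) (measurable_preLevelProb κ k q i) ih u
    rw [← levelProb_eq] at h
    exact ⟨pow_nonneg h.1 _, pow_le_one₀ h.1 h.2⟩

/-- Level `i` contributes independent noise to each block. All higher levels see a block only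
through its parent, because successive floor divisions compose. -/
theorem levelCov_step (hk : IsClusterSeq s k) {i : ℕ} (hi : i < s) {N M : ℕ}
    (π : Fin N → Fin M) (hπ : ∀ b, (π b).val = b.val / (k (i + 1) / k i)) :
    levelCov s k q N i =
      (levelCov s k q M (i + 1)).submatrix π π + (q i - q (i + 1)) • 1 := by
  rw [levelCov, Finset.sum_eq_sum_Ico_succ_bot (by omega), add_comm,
    Nat.div_self (hk.pos (by omega)), blockOnes_one]
  congr 1
  ext a b
  simp only [levelCov, Matrix.sum_apply, submatrix_apply, Matrix.smul_apply, blockOnes, of_apply,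
    hπ, Nat.div_div_eq_div_mul]
  refine Finset.sum_congr rfl fun j hj => ?_
  rw [Finset.mem_Ico] at hj
  obtain ⟨x, hx⟩ := hk.dvd_succ i hi
  obtain ⟨y, hy⟩ := hk.dvd hj.1 (by omega)
  have h0 := hk.pos hi.le
  have h1 := hk.pos (i := i + 1) hi
  have h3 : k (i + 1) / k i * (k j / k (i + 1)) = k j / k i := by
    rw [hy, Nat.mul_div_cancel_left _ h1, hx, mul_assoc, Nat.mul_div_cancel_left _ h0,
      Nat.mul_div_cancel_left _ h0]
  rw [h3]

/-- The integral does not depend on the level `i`: integrating out the noise of one level merges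
sibling blocks into their parent. The induction descends from the root. -/
theorem integral_preLevelProb (hk : IsClusterSeq s k) (hq : IsOverlapSeq s q) (κ : ℝ) {i : ℕ}
    (hi : i ≤ s) : ∀ N : ℕ, N * k i = k s →
      ∫ y, ∏ b, preLevelProb κ k q i (y b)
        ∂multivariateGaussian (0 : EuclideanSpace ℝ (Fin N)) (levelCov s k q N i) =
      levelProb κ k q s 0 := by
  induction hi using Nat.decreasingInduction with
  | self =>
    intro N hN
    obtain rfl : N = 1 := Nat.eq_of_mul_eq_mul_right (hk.pos le_rfl) (by rw [hN, one_mul])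
    have h := integral_prod_multivariateGaussian_submatrix (ι := Fin 1) (ι' := Fin 1)
      (PosSemidef.zero (R := ℝ) (n := Fin 1)) id (r := 1) (by intro c; simp [Subsingleton.elim _ c])
      √(q s - q (s + 1)) (measurable_preLevelProb κ k q s) (preLevelProb_mem_Icc κ k q s)
    rw [Real.sq_sqrt (hq.sub_pos le_rfl).le] at h
    -- At the root, the only remaining noise is added to the constant `0`, a Gaussian with zero
    -- covariance.
    have hz : multivariateGaussian (0 : EuclideanSpace ℝ (Fin 1)) 0 = Measure.dirac 0 := by
      simp [multivariateGaussian]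
    rw [hz, integral_dirac] at h
    have hQ : levelCov s k q 1 s =
        (0 : Matrix (Fin 1) (Fin 1) ℝ).submatrix id id + (q s - q (s + 1)) • 1 := by
      simp [levelCov, Nat.div_self (hk.pos le_rfl), blockOnes_one]
    rw [hQ, h, levelProb_eq]
    simp
  | of_succ i hi ih =>
    intro N hN
    obtain ⟨M, hM⟩ := hk.dvd (i := i + 1) hi le_rfl
    obtain ⟨x, hx⟩ := hk.dvd_succ i hi
    have h0 := hk.pos (i := i) (by omega)
    have hr : k (i + 1) / k i = x := by rw [hx, Nat.mul_div_cancel_left _ h0]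
    have hx0 : 0 < x := Nat.pos_of_ne_zero fun h => by
      have := hk.pos (i := i + 1) hi
      simp [hx, h] at this
    have hNM : N = M * x := Nat.eq_of_mul_eq_mul_right h0 (by rw [hN, hM, hx]; ring)
    let π : Fin N → Fin M := fun b => ⟨b.val / x, Nat.div_lt_of_lt_mul (by
      have := b.2; rw [mul_comm]; omega)⟩
    rw [levelCov_step hk hi (N := N) (M := M) π (by intro b; rw [hr]),
      ← Real.sq_sqrt (hq.sub_pos (i := i) (by omega)).le,
      integral_prod_multivariateGaussian_submatrix (posSemidef_levelCov hq _ _) π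
        (card_filter_div_eq hx0 hNM π fun b => rfl) _
        (measurable_preLevelProb κ k q i) (preLevelProb_mem_Icc κ k q i), ← levelProb_eq]
    rw [← ih M (by rw [hM, mul_comm])]
    simp only [preLevelProb, hr]

theorem boxProb_ultMatrix (hk : IsClusterSeq s k) (hq : IsOverlapSeq s q) (κ : ℝ) :
    boxProb κ (ultMatrix s k q) = levelProb κ k q s 0 := by
  rw [← integral_preLevelProb hk hq κ (Nat.zero_le s) (k s) (by simp [hk.zero]),
    levelCov_zero hk, boxProb]
  have hm : MeasurableSet {g : EuclideanSpace ℝ (Fin (k s)) | ∀ a, |g a| ≤ κ} := by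
    simp only [Set.ofPred_forall]
    exact MeasurableSet.iInter fun a => measurableSet_le (by fun_prop) measurable_const
  rw [← integral_indicator_one hm]
  congr 1
  ext g
  simp only [preLevelProb, Set.indicator_apply, Pi.one_apply, Set.mem_ofPred_eq, Set.mem_Icc,
    abs_le]
  rw [Finset.prod_ite_zero]
  simp

/-- A nondegenerate Gaussian charges every nonempty open set, hence both the interior and the
complement of the interval. Powers with positive exponent and averages stay strictly between `0` and
`1`. -/
theorem levelProb_mem_Ioo {κ : ℝ} (hκ : 0 < κ) (hq : IsOverlapSeq s q) (i : ℕ)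
    (hki : ∀ j < i, 0 < k (j + 1) / k j) (u : ℝ) :
    levelProb κ k q i u ∈ Set.Ioo (0 : ℝ) 1 := by
  induction i generalizing u with
  | zero =>
    have hσ : 0 < √(q 0 - q 1) := Real.sqrt_pos.2 (hq.sub_pos (Nat.zero_le s))
    set σ := √(q 0 - q 1)
    have h : levelProb κ k q 0 u =
        (gaussianReal 0 1).real ((fun t => u + σ * t) ⁻¹' Set.Icc (-κ) κ) := by
      rw [← integral_indicator_one (measurableSet_Icc.preimage (by fun_prop))]
      rfl
    have hpos : ∀ U : Set ℝ, IsOpen U → U.Nonempty → gaussianReal 0 1 U ≠ 0 := by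
      intro U hU hne h0
      exact hU.measure_ne_zero volume hne
        (gaussianReal_absolutelyContinuous' 0 one_ne_zero h0)
    rw [h]
    constructor
    · refine ENNReal.toReal_pos (fun h0 => ?_) (measure_ne_top _ _)
      refine hpos ((fun t => u + σ * t) ⁻¹' Set.Ioo (-κ) κ) (isOpen_Ioo.preimage (by fun_prop))
        ⟨-u / σ, ?_⟩ (measure_mono_null (Set.preimage_mono Set.Ioo_subset_Icc_self) h0)
      have : u + σ * (-u / σ) = 0 := by field_simp; ring
      simp [this, hκ]
    · have hc := measureReal_compl (μ := gaussianReal 0 1)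
        (s := (fun t => u + σ * t) ⁻¹' Set.Icc (-κ) κ) (measurableSet_Icc.preimage (by fun_prop))
      have : 0 < (gaussianReal 0 1).real ((fun t => u + σ * t) ⁻¹' Set.Icc (-κ) κ)ᶜ := by
        refine ENNReal.toReal_pos (hpos _ (isClosed_Icc.preimage (by fun_prop)).isOpen_compl
          ⟨(κ + 1 - u) / σ, ?_⟩) (measure_ne_top _ _)
        have : u + σ * ((κ + 1 - u) / σ) = κ + 1 := by field_simp; ring
        simp [this]
      rw [hc] at this
      simpa using this
  | succ i ih =>
    rw [levelProb]
    refine gaussSmooth_mem_Ioo _ ((measurable_levelProb κ k q i).pow_const _) (fun v => ?_) u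
    have h := ih (fun j hj => hki j (by omega)) v
    exact ⟨pow_pos h.1 _, pow_lt_one₀ h.1.le h.2 (hki i (by omega)).ne'⟩

theorem IsClusterSeq.div_pos (hk : IsClusterSeq s k) {j : ℕ} (hj : j < s) :
    0 < k (j + 1) / k j :=
  Nat.div_pos (hk.lt_succ j hj).le (hk.pos hj.le)

end Cluster

/-! ### Spectrum and determinant of the ultrametric matrix -/

section Eigenvalues

variable {s : ℕ} {k : ℕ → ℕ} {q : ℕ → ℝ}

/-- The eigenvalue `∑_{j ≤ i} k_j (q_j - q_{j+1})` of the ultrametric overlap matrix. -/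
def levelEigenvalue (k : ℕ → ℕ) (q : ℕ → ℝ) (i : ℕ) : ℝ :=
  ∑ j ∈ Finset.range (i + 1), (k j : ℝ) * (q j - q (j + 1))

theorem levelEigenvalue_succ (k : ℕ → ℕ) (q : ℕ → ℝ) (i : ℕ) :
    levelEigenvalue k q (i + 1) =
      levelEigenvalue k q i + (k (i + 1) : ℝ) * (q (i + 1) - q (i + 2)) :=
  Finset.sum_range_succ _ _

theorem levelEigenvalue_zero (hk : IsClusterSeq s k) (hq : IsOverlapSeq s q) :
    levelEigenvalue k q 0 = 1 - q 1 := by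
  simp [levelEigenvalue, hk.zero, hq.zero]

theorem levelEigenvalue_pos (hk : IsClusterSeq s k) (hq : IsOverlapSeq s q) {i : ℕ} (hi : i ≤ s) :
    0 < levelEigenvalue k q i := by
  refine Finset.sum_pos (fun j hj => ?_) (by simp)
  rw [Finset.mem_range] at hj
  exact mul_pos (Nat.cast_pos.2 (hk.pos (by omega))) (hq.sub_pos (by omega))

/-- The numbers `cw` are the coefficients of the inverse of `Q` in the block matrices, so their
weighted partial sums are the reciprocal eigenvalues. -/
theorem sum_cw (hk : IsClusterSeq s k) (hq : IsOverlapSeq s q) {i : ℕ} (hi : i ≤ s) :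
    ∑ j : Fin (i + 1), (k j : ℝ) * cw k q (j + 1) = (levelEigenvalue k q i)⁻¹ := by
  induction i with
  | zero => simp [levelEigenvalue_zero hk hq, hk.zero, cw]
  | succ i ih =>
    have h := ih (by omega)
    rw [Fin.sum_univ_castSucc]
    simp only [Fin.val_castSucc, Fin.val_last]
    rw [h, show i + 1 + 1 = i + 2 from rfl, cw, h, levelEigenvalue_succ]
    have h1 := levelEigenvalue_pos hk hq (i := i) (by omega)
    have h2 := hq.sub_pos hi
    have h3 : (0 : ℝ) < k (i + 1) := Nat.cast_pos.2 (hk.pos hi)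
    rw [show i + 1 + 1 = i + 2 from rfl] at h2
    generalize levelEigenvalue k q i = L at *
    generalize q (i + 1) - q (i + 2) = v at *
    generalize (k (i + 1) : ℝ) = K at *
    have : L + K * v ≠ 0 := by positivity
    field_simp
    ring

/-- This is a difference of consecutive reciprocal eigenvalues. It shows that the square roots of
`-cw` in `Dval` are taken of positive numbers. -/
theorem neg_cw (hk : IsClusterSeq s k) (hq : IsOverlapSeq s q) {i : ℕ} (hi : i < s) :
    -cw k q (i + 2) = (q (i + 1) - q (i + 2)) /
      (levelEigenvalue k q i * levelEigenvalue k q (i + 1)) := by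
  rw [cw, sum_cw hk hq hi.le, levelEigenvalue_succ]
  have h1 := levelEigenvalue_pos hk hq hi.le
  have h2 := hq.sub_pos (i := i + 1) hi
  have h3 : (0 : ℝ) < k (i + 1) := Nat.cast_pos.2 (hk.pos hi)
  rw [show i + 1 + 1 = i + 2 from rfl] at h2
  generalize levelEigenvalue k q i = L at *
  generalize q (i + 1) - q (i + 2) = v at *
  generalize (k (i + 1) : ℝ) = K at *
  have : L + K * v ≠ 0 := by positivity
  field_simp

/-- The normalising constant of the `i`-th nested integral. -/
def levelConst (k : ℕ → ℕ) (q : ℕ → ℝ) : ℕ → ℝ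
  | 0 => 1
  | i + 1 => levelConst k q i ^ (k (i + 1) / k i) *
      √(levelEigenvalue k q (i + 1) / levelEigenvalue k q i)

theorem levelConst_pos (hk : IsClusterSeq s k) (hq : IsOverlapSeq s q) {i : ℕ} (hi : i ≤ s) :
    0 < levelConst k q i := by
  induction i with
  | zero => exact one_pos
  | succ i ih =>
    exact mul_pos (pow_pos (ih (by omega)) _) (Real.sqrt_pos.2
      (div_pos (levelEigenvalue_pos hk hq hi) (levelEigenvalue_pos hk hq (by omega))))

theorem card_filter_div_eq_div {K l : ℕ} (hl : 0 < l) (hK : l ∣ K) {x : ℕ} (hx : x < K / l) :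
    (Finset.univ.filter fun c : Fin K => c.val / l = x).card = l := by
  have h := card_filter_div_eq (M := K / l) hl (Nat.div_mul_cancel hK).symm
    (fun b : Fin K => ⟨b.val / l, Nat.div_lt_div_of_lt_of_dvd hK b.2⟩) (fun b => rfl) ⟨x, hx⟩
  simpa [Fin.ext_iff] using h

theorem blockOnes_mul_blockOnes {K l m : ℕ} (hl : 0 < l) (hlm : l ∣ m) (hmK : m ∣ K) :
    blockOnes K l * blockOnes K m = (l : ℝ) • blockOnes K m := by
  ext a b
  obtain ⟨x, rfl⟩ := hlm
  have hlK : l ∣ K := (Dvd.intro _ rfl).trans hmK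
  simp only [mul_apply, blockOnes, of_apply, Matrix.smul_apply, smul_eq_mul, mul_ite, mul_one,
    mul_zero]
  have h : ∀ c : Fin K, (if c.val / (l * x) = b.val / (l * x) then
      (if a.val / l = c.val / l then (1 : ℝ) else 0) else 0) =
      if c.val / l = a.val / l then (if a.val / (l * x) = b.val / (l * x) then 1 else 0) else 0 := by
    intro c
    by_cases hc : c.val / l = a.val / l
    · simp [← Nat.div_div_eq_div_mul, hc]
    · simp [hc, Ne.symm hc]
  simp_rw [h]
  rw [← Finset.sum_filter, Finset.sum_const, card_filter_div_eq_div hl hlK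
    (Nat.div_lt_div_of_lt_of_dvd hlK a.2)]
  simp

/-- Sylvester's identity replaces `U * Uᵀ` by `Uᵀ * U`, which is `l` times the identity of size `K /
l`. -/
theorem det_one_add_smul_blockOnes {K l : ℕ} (hl : 0 < l) (hlK : l ∣ K) (c : ℝ) :
    (1 + c • blockOnes K l).det = (1 + c * l) ^ (K / l) := by
  let U : Matrix (Fin K) (Fin (K / l)) ℝ :=
    Matrix.of fun a b => if a.val / l = b.val then 1 else 0
  have h1 : blockOnes K l = U * Uᵀ := by
    ext a b
    simp only [blockOnes, U, of_apply, mul_apply, transpose_apply, mul_ite, mul_one, mul_zero]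
    rw [Finset.sum_eq_single_of_mem
      (⟨a.val / l, Nat.div_lt_div_of_lt_of_dvd hlK a.2⟩ : Fin (K / l)) (Finset.mem_univ _)]
    · simp [eq_comm]
    · intro c _ hc
      have : ¬ a.val / l = c.val := fun h => hc (Fin.ext h.symm)
      simp [this]
  have h2 : Uᵀ * U = (l : ℝ) • 1 := by
    ext b b'
    simp only [U, of_apply, mul_apply, transpose_apply, mul_ite, mul_one, mul_zero,
      Matrix.smul_apply, smul_eq_mul]
    by_cases hb : b = b'
    · subst hb
      have : ∀ x : Fin K, (if x.val / l = b.val then (if x.val / l = b.val then (1 : ℝ) else 0)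
          else 0) = if x.val / l = b.val then 1 else 0 := fun x => by split_ifs <;> rfl
      simp_rw [this]
      rw [Finset.sum_boole, card_filter_div_eq_div hl hlK b.2]
      simp
    · rw [one_apply_ne hb, mul_zero]
      refine Finset.sum_eq_zero fun x _ => ?_
      split_ifs with h3 h4
      · exact absurd (Fin.ext (h4.symm.trans h3)) hb
      · rfl
      · rfl
  rw [h1, ← Matrix.smul_mul, det_one_add_mul_comm, Matrix.mul_smul, h2, smul_smul]
  rw [← one_smul ℝ (1 : Matrix (Fin (K / l)) (Fin (K / l)) ℝ), smul_smul, ← add_smul, det_smul]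
  simp

theorem partialSum_mul_blockOnes (hk : IsClusterSeq s k) {i j : ℕ} (hij : i ≤ j) (hj : j ≤ s) :
    (∑ l ∈ Finset.range (i + 1), (q l - q (l + 1)) • blockOnes (k s) (k l)) *
        blockOnes (k s) (k j) =
      levelEigenvalue k q i • blockOnes (k s) (k j) := by
  rw [levelEigenvalue, Finset.sum_mul, Finset.sum_smul]
  refine Finset.sum_congr rfl fun l hl => ?_
  rw [Finset.mem_range] at hl
  rw [smul_mul_assoc, blockOnes_mul_blockOnes (hk.pos (by omega)) (hk.dvd (by omega) hj)
    (hk.dvd hj le_rfl), smul_smul, mul_comm]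

/-- The partial sum up to level `i` acts on `blockOnes (k s) (k (i + 1))` as a scalar, so adding the
next level amounts to multiplying by `1 + c • blockOnes`. The determinants of these factors are the
squares of the square roots in `levelConst`. -/
theorem det_partialSum (hk : IsClusterSeq s k) (hq : IsOverlapSeq s q) {i : ℕ} (hi : i ≤ s) :
    (∑ l ∈ Finset.range (i + 1), (q l - q (l + 1)) • blockOnes (k s) (k l)).det =
      levelEigenvalue k q 0 ^ k s * levelConst k q i ^ (2 * (k s / k i)) := by
  induction i with
  | zero => simp [levelConst, hk.zero, blockOnes_one, levelEigenvalue]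
  | succ i ih =>
    have h0 := levelEigenvalue_pos hk hq (i := i) (by omega)
    have h1 := levelEigenvalue_pos hk hq hi
    have hP := partialSum_mul_blockOnes (q := q) hk (Nat.le_succ i) hi
    rw [Finset.sum_range_succ]
    have hfac : (∑ l ∈ Finset.range (i + 1), (q l - q (l + 1)) • blockOnes (k s) (k l)) +
        (q (i + 1) - q (i + 1 + 1)) • blockOnes (k s) (k (i + 1)) =
        (∑ l ∈ Finset.range (i + 1), (q l - q (l + 1)) • blockOnes (k s) (k l)) *
          (1 + ((q (i + 1) - q (i + 1 + 1)) / levelEigenvalue k q i) •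
            blockOnes (k s) (k (i + 1))) := by
      rw [mul_add, mul_one, mul_smul_comm, hP, smul_smul, div_mul_cancel₀ _ h0.ne']
    have hL : 1 + (q (i + 1) - q (i + 1 + 1)) / levelEigenvalue k q i * k (i + 1) =
        levelEigenvalue k q (i + 1) / levelEigenvalue k q i := by
      rw [levelEigenvalue_succ]
      field_simp
    rw [hfac, det_mul, ih (by omega), det_one_add_smul_blockOnes (hk.pos hi) (hk.dvd hi le_rfl), hL,
      mul_assoc]
    congr 1
    obtain ⟨x, hx⟩ := hk.dvd_succ i hi
    obtain ⟨y, hy⟩ := hk.dvd hi le_rfl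
    have hki := hk.pos (i := i) (by omega)
    have hki' := hk.pos hi
    have e1 : k (i + 1) / k i = x := by rw [hx, Nat.mul_div_cancel_left _ hki]
    have e2 : k s / k (i + 1) = y := by rw [hy, Nat.mul_div_cancel_left _ hki']
    have e3 : k s / k i = x * y := by rw [hy, hx, mul_assoc, Nat.mul_div_cancel_left _ hki]
    rw [levelConst, e1, e2, e3, mul_pow, ← pow_mul, pow_mul √_, Real.sq_sqrt (div_pos h1 h0).le]
    congr 2
    ring

end Eigenvalues

/-! ### The nested integrals compute the box probability -/

section NestedIntegral

variable {s : ℕ} {k : ℕ → ℕ} {q : ℕ → ℝ}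

theorem erf_neg (x : ℝ) : erf (-x) = -erf x := by
  have h := intervalIntegral.integral_comp_neg (a := 0) (b := x) fun t => Real.exp (-t ^ 2)
  simp only [neg_sq, neg_zero] at h
  rw [erf, erf, h, intervalIntegral.integral_symm]
  ring

theorem erf_sub_erf (a b : ℝ) :
    (erf (√2 * b / 2) - erf (√2 * a / 2)) / 2 =
      1 / √(2 * Real.pi) * ∫ t in a..b, Real.exp (-t ^ 2 / 2) := by
  have hint : ∀ x y : ℝ, IntervalIntegrable (fun t : ℝ => Real.exp (-t ^ 2)) volume x y :=
    fun x y => Continuous.intervalIntegrable (by fun_prop) _ _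
  have h := intervalIntegral.mul_integral_comp_mul_right (a := a) (b := b)
    (f := fun t : ℝ => Real.exp (-t ^ 2)) (√2 / 2)
  have h2 : ∀ t : ℝ, -(t * (√2 / 2)) ^ 2 = -t ^ 2 / 2 := by
    intro t
    rw [mul_pow, div_pow, Real.sq_sqrt (by norm_num)]
    ring
  simp only [h2] at h
  rw [erf, erf, ← mul_sub, intervalIntegral.integral_interval_sub_left (hint _ _) (hint _ _),
    show √2 * b / 2 = b * (√2 / 2) by ring, show √2 * a / 2 = a * (√2 / 2) by ring, ← h,
    Real.sqrt_mul (by norm_num)]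
  have h3 : √2 * √2 = 2 := Real.mul_self_sqrt (by norm_num)
  have h4 : √Real.pi ≠ 0 := (Real.sqrt_pos.2 Real.pi_pos).ne'
  generalize (∫ t in a..b, Real.exp (-t ^ 2 / 2)) = I
  field_simp
  linear_combination I * h3

theorem gaussSmooth_eq_integral (σ : ℝ) (f : ℝ → ℝ) (u : ℝ) :
    gaussSmooth σ f u = 1 / √(2 * Real.pi) * ∫ t, f (u + σ * t) * Real.exp (-t ^ 2 / 2) := by
  rw [gaussSmooth, integral_gaussianReal_eq_integral_smul one_ne_zero, ← integral_const_mul]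
  congr 1
  ext t
  simp [gaussianPDFReal]
  ring

theorem gaussSmooth_indicator_Icc {σ κ : ℝ} (hσ : 0 < σ) (hκ : 0 < κ) (u : ℝ) :
    gaussSmooth σ (Set.indicator (Set.Icc (-κ) κ) 1) u =
      -(erf (√2 * (u / σ) / 2 - √2 * (κ / σ) / 2) - erf (√2 * (u / σ) / 2 + √2 * (κ / σ) / 2)) /
        2 := by
  have hle : -(u / σ + κ / σ) ≤ -(u / σ - κ / σ) := by
    have : 0 < κ / σ := by positivity
    linarith
  have h1 : √2 * (u / σ) / 2 - √2 * (κ / σ) / 2 = -(√2 * -(u / σ - κ / σ) / 2) := by ring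
  have h2 : √2 * (u / σ) / 2 + √2 * (κ / σ) / 2 = -(√2 * -(u / σ + κ / σ) / 2) := by ring
  -- Oddness of `erf` accounts for the reversed order and the leading minus sign in `Itilde`.
  rw [h1, h2, erf_neg, erf_neg]
  have h3 := erf_sub_erf (-(u / σ + κ / σ)) (-(u / σ - κ / σ))
  rw [show ∀ x y : ℝ, -(-x - -y) / 2 = (x - y) / 2 by intros; ring, h3, gaussSmooth_eq_integral]
  congr 1
  rw [intervalIntegral.integral_of_le hle, ← integral_Icc_eq_integral_Ioc,
    ← integral_indicator measurableSet_Icc]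
  congr 1
  ext t
  have hiff : u + σ * t ∈ Set.Icc (-κ) κ ↔ t ∈ Set.Icc (-(u / σ + κ / σ)) (-(u / σ - κ / σ)) := by
    rw [Set.mem_Icc, Set.mem_Icc, ← add_div, ← sub_div, ← neg_div, ← neg_div, div_le_iff₀ hσ,
      le_div_iff₀ hσ]
    constructor <;> rintro ⟨h, h'⟩ <;> constructor <;> linarith
  simp only [Set.indicator_apply, hiff]
  split_ifs <;> simp

/-- The linear combination of `z_{i+1}, …, z_s` on which the `i`-th nested integral depends. -/
def tailSum (s : ℕ) (k : ℕ → ℕ) (q : ℕ → ℝ) (i : ℕ) (z : ℕ → ℝ) : ℝ :=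
  ∑ j ∈ Finset.Icc (i + 1) s, √(-cw k q (j + 1)) * z j

theorem tailSum_update {i : ℕ} (hi : i < s) (z : ℕ → ℝ) (t : ℝ) :
    tailSum s k q i (Function.update z (i + 1) t) =
      tailSum s k q (i + 1) z + √(-cw k q (i + 2)) * t := by
  rw [tailSum, tailSum, ← Finset.add_sum_Ioc_eq_sum_Icc (show i + 1 ≤ s from hi),
    Function.update_self, add_comm]
  congr 1
  refine Finset.sum_congr (by ext; simp [Finset.mem_Ioc, Finset.mem_Icc]) fun j hj => ?_
  rw [Finset.mem_Icc] at hj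
  rw [Function.update_of_ne (by omega)]

theorem Itilde_zero_eq (hk : IsClusterSeq s k) (hq : IsOverlapSeq s q) {κ : ℝ} (hκ : 0 < κ)
    (z : ℕ → ℝ) :
    Itilde κ s k q 0 z =
      Real.exp (k 0 * levelEigenvalue k q 0 * tailSum s k q 0 z ^ 2 / 2) *
        levelProb κ k q 0 (levelEigenvalue k q 0 * tailSum s k q 0 z) := by
  have hv : 0 < 1 - q 1 := by have := hq.sub_pos (Nat.zero_le s); rwa [hq.zero] at this
  have hσ : 0 < √(1 - q 1) := Real.sqrt_pos.2 hv
  have hσ2 : √(1 - q 1) ^ 2 = 1 - q 1 := Real.sq_sqrt hv.le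
  have hc : √(cw k q 1) = (√(1 - q 1))⁻¹ := by rw [cw, one_div, Real.sqrt_inv]
  have hD : Dval s k q z = √(1 - q 1) * tailSum s k q 0 z := by
    rw [Dval, tailSum, Finset.mul_sum]
    refine Finset.sum_congr rfl fun j _ => ?_
    rw [hc]
    field_simp
  have hE : Eval κ k q = κ / √(1 - q 1) := by rw [Eval, hc]; field_simp
  rw [levelProb, hq.zero, gaussSmooth_indicator_Icc hσ hκ, Itilde, hD, hE,
    levelEigenvalue_zero hk hq, hk.zero]
  have h1 : (1 - q 1) * tailSum s k q 0 z / √(1 - q 1) = √(1 - q 1) * tailSum s k q 0 z := by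
    nth_rewrite 1 [← hσ2]
    field_simp
  rw [h1, mul_pow, hσ2, Nat.cast_one, one_mul]
  ring

/-- Completing the square: the Gaussian weight in `t`, together with the exponential prefactor from
level `i`, is again a Gaussian weight after an affine change of variable. What is left over is the
prefactor of level `i + 1`. -/
theorem Itilde_eq (hk : IsClusterSeq s k) (hq : IsOverlapSeq s q) {κ : ℝ} (hκ : 0 < κ)
    {i : ℕ} (hi : i ≤ s) (z : ℕ → ℝ) :
    Itilde κ s k q i z = levelConst k q i *
      (Real.exp (k i * levelEigenvalue k q i * tailSum s k q i z ^ 2 / 2) *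
        levelProb κ k q i (levelEigenvalue k q i * tailSum s k q i z)) := by
  induction i generalizing z with
  | zero => rw [Itilde_zero_eq hk hq hκ, levelConst, one_mul]
  | succ i ih =>
    have hL0 := levelEigenvalue_pos hk hq (i := i) (by omega)
    have hL1 := levelEigenvalue_pos hk hq hi
    have hv : 0 < q (i + 1) - q (i + 2) := hq.sub_pos hi
    have hc := neg_cw hk hq (i := i) hi
    have hc0 : 0 < -cw k q (i + 2) := by rw [hc]; positivity
    have hLs := levelEigenvalue_succ k q i
    obtain ⟨r, hr⟩ := hk.dvd_succ i hi
    have hki := hk.pos (i := i) (by omega)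
    have hr' : k (i + 1) / k i = r := by rw [hr, Nat.mul_div_cancel_left _ hki]
    rw [Itilde, levelProb, gaussSmooth_eq_integral, levelConst]
    simp_rw [ih (by omega), tailSum_update (show i < s from hi), hr']
    set w := tailSum s k q (i + 1) z
    set l := √(-cw k q (i + 2)) with hl
    set σ := √(q (i + 1) - q (i + 2)) with hσd
    have hl2 : l ^ 2 = -cw k q (i + 2) := Real.sq_sqrt hc0.le
    have hl0 : 0 < l := Real.sqrt_pos.2 hc0
    have hσ2 : σ ^ 2 = q (i + 1) - q (i + 2) := Real.sq_sqrt hv.le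
    have hσ0 : 0 < σ := Real.sqrt_pos.2 hv
    rw [hc, ← hσ2] at hl2
    rw [← hσ2] at hLs
    clear_value l σ w
    have hkr : (k (i + 1) : ℝ) = k i * r := by rw [hr]; push_cast; ring
    set L := levelEigenvalue k q i
    set L' := levelEigenvalue k q (i + 1)
    -- The new variable `x = a * t + b` is chosen so that `L * (w + l * t) = L' * w + σ * x`, the
    -- argument in `levelProb` at the next level.
    set a := L * l / σ with ha
    set b := (L - L') * w / σ with hb
    have ha0 : 0 < a := by positivity
    -- The Jacobian is the factor that `levelConst` gains at this level.
    have ha2 : a⁻¹ = √(L' / L) := by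
      rw [eq_comm, Real.sqrt_eq_iff_mul_self_eq (by positivity) (by positivity), ha]
      field_simp
      rw [hl2]
      field_simp
    set g : ℝ → ℝ := fun x => levelConst k q i ^ r * Real.exp (k (i + 1) * L' * w ^ 2 / 2) *
      (levelProb κ k q i (L' * w + σ * x) ^ r * Real.exp (-x ^ 2 / 2)) with hg
    have hint : ∀ t, (levelConst k q i * (Real.exp (k i * L * (w + l * t) ^ 2 / 2) *
        levelProb κ k q i (L * (w + l * t)))) ^ r * Real.exp (-t ^ 2 / 2) = g (a * t + b) := by
      intro t
      have e1 : L' * w + σ * (a * t + b) = L * (w + l * t) := by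
        rw [ha, hb]; field_simp; ring
      have e2 : (r : ℝ) * (k i * L * (w + l * t) ^ 2 / 2) + -t ^ 2 / 2 =
          k (i + 1) * L' * w ^ 2 / 2 + -(a * t + b) ^ 2 / 2 := by
        have hl3 : l ^ 2 * (L * L') = σ ^ 2 := by rw [hl2]; field_simp
        have e3 : σ ^ 2 * (a * t + b) ^ 2 = (L * l * t + (L - L') * w) ^ 2 := by
          rw [ha, hb]; field_simp
        have hne : σ ^ 2 * L' ≠ 0 := by positivity
        refine mul_left_cancel₀ hne ?_
        rw [hkr] at hLs ⊢
        linear_combination -(L' * L * (w + l * t) ^ 2 - L' ^ 2 * w ^ 2) / 2 * hLs +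
          t ^ 2 * L' / 2 * hl3 + L' / 2 * e3
      rw [hg]
      simp only [e1, mul_pow, ← Real.exp_nat_mul]
      rw [show ∀ x y u v : ℝ, x * (y * u) * v = x * (y * v) * u by intros; ring,
        show ∀ x y u v : ℝ, x * y * (u * v) = x * (y * v) * u by intros; ring,
        ← Real.exp_add, ← Real.exp_add, e2]
    simp_rw [hint]
    have hcv := Measure.integral_comp_mul_left (fun x => g (x + b)) a
    rw [hcv, integral_add_right_eq_self g b, hg, integral_const_mul, abs_of_pos (inv_pos.2 ha0),
      ha2, smul_eq_mul]
    ring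

theorem pFactor_eq_boxProb (hs : 1 ≤ s) (hk : IsClusterSeq s k) (hq : IsOverlapSeq s q) {κ : ℝ}
    (hκ : 0 < κ) : pFactor κ s k q = boxProb κ (ultMatrix s k q) := by
  have hA := levelConst_pos hk hq (le_refl s)
  have hL := levelEigenvalue_pos hk hq (Nat.zero_le s)
  have hI : pFactor κ s k q =
      1 / (√(cw k q 1) ^ k s * √(ultMatrix s k q).det) * Itilde κ s k q s 0 := by
    obtain ⟨s, rfl⟩ : ∃ t, s = t + 1 := ⟨s - 1, by omega⟩
    rw [pFactor, Itilde, Nat.add_sub_cancel, mul_assoc]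
  -- At the root no variables remain, so the exponential is `1` and `levelProb` is evaluated at `0`.
  have htail : tailSum s k q s 0 = 0 := by simp [tailSum]
  have hdet : (ultMatrix s k q).det = levelEigenvalue k q 0 ^ k s * levelConst k q s ^ 2 := by
    rw [ultMatrix, det_partialSum hk hq le_rfl, Nat.div_self (hk.pos le_rfl)]
  have hc : √(cw k q 1) = (√(levelEigenvalue k q 0))⁻¹ := by
    rw [cw, levelEigenvalue_zero hk hq, one_div, Real.sqrt_inv]
  have hpow : √(levelEigenvalue k q 0 ^ k s) = √(levelEigenvalue k q 0) ^ k s := by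
    rw [Real.sqrt_eq_iff_mul_self_eq (by positivity) (by positivity), ← mul_pow,
      Real.mul_self_sqrt hL.le]
  rw [hI, Itilde_eq hk hq hκ le_rfl, htail, hdet, hc, boxProb_ultMatrix hk hq,
    Real.sqrt_mul (by positivity), Real.sqrt_sq hA.le, hpow, ← mul_assoc, inv_pow]
  have := Real.sqrt_pos.2 hL
  simp
  field_simp

theorem boxProb_ultMatrix_mem_Ioo (hk : IsClusterSeq s k) (hq : IsOverlapSeq s q) {κ : ℝ}
    (hκ : 0 < κ) : boxProb κ (ultMatrix s k q) ∈ Set.Ioo (0 : ℝ) 1 := by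
  rw [boxProb_ultMatrix hk hq]
  exact levelProb_mem_Ioo hκ hq s (fun j hj => hk.div_pos hj) 0

end NestedIntegral

/-! ### Sign partitions and the entropy program -/

section Partition

variable {K : ℕ}

/-- The restriction of the sign pattern of a finest interval to the first `j + 1` vectors. -/
def truncate (j : Fin K) (u : FinestPart K) : Part K :=
  ⟨(j, fun i => if i ≤ j then u.1.1.2 i else true), fun i hi => by
    dsimp only
    split_ifs with h
    · exact u.1.2 i (hi.elim Or.inl fun h' => absurd h (not_le.2 h'))
    · rfl⟩

theorem eq_truncate_iff (j : Fin K) (u : FinestPart K) (v : Part K) :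
    v = truncate j u ↔ v.1.1 = j ∧ ∀ i ≤ v.1.1, u.1.1.2 i = v.1.2 i := by
  constructor
  · rintro rfl
    exact ⟨rfl, fun i hi => by
      change i ≤ j at hi
      simp [truncate, hi]⟩
  · rintro ⟨h, h'⟩
    refine Subtype.ext (Prod.ext h (funext fun i => ?_))
    by_cases hi : i ≤ j
    · simp [truncate, hi, h' i (h ▸ hi)]
    · simp [truncate, hi, v.2 i (Or.inr (by rw [h]; exact not_le.1 hi))]

theorem FinestPart.ext_signs {u u' : FinestPart K} (h : ∀ i, u.1.1.2 i = u'.1.1.2 i) : u = u' := by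
  refine Subtype.ext (Subtype.ext (Prod.ext (Fin.ext ?_) (funext h)))
  have := u.2
  have := u'.2
  omega

/-- The lengths of the intervals of all steps that are induced by lengths of the finest ones. -/
def marginal (p : FinestPart K → ℝ) (v : Part K) : ℝ :=
  ∑ u, if ∀ i ≤ v.1.1, u.1.1.2 i = v.1.2 i then p u else 0

/-- The total length of the finest intervals on which the vectors `i` and `j` agree. -/
def agreeMass (p : FinestPart K → ℝ) (i j : Fin K) : ℝ :=
  ∑ u : FinestPart K, if u.1.1.2 i = u.1.1.2 j then p u else 0

theorem agreeMass_eq_sum_mul (p : FinestPart K → ℝ) (i j : Fin K) :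
    agreeMass p i j = ∑ u : FinestPart K, (if u.1.1.2 i = u.1.1.2 j then 1 else 0) * p u := by
  simp [agreeMass]

/-- Each finest cell lies in exactly one cell of step `j`. Both kinds of constraint rows reduce to
sums of this form. -/
theorem sum_indicator_mul_marginal (p : FinestPart K → ℝ) (j : Fin K) (P : Part K → Prop)
    [DecidablePred P] :
    ∑ v : Part K, (if v.1.1 = j ∧ P v then 1 else 0) * marginal p v =
      ∑ u, if P (truncate j u) then p u else 0 := by
  simp_rw [marginal, Finset.mul_sum]
  rw [Finset.sum_comm]
  refine Finset.sum_congr rfl fun u _ => ?_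
  rw [Finset.sum_eq_single_of_mem (truncate j u) (Finset.mem_univ _)]
  · have h := (eq_truncate_iff j u _).1 rfl
    rw [if_pos h.2]
    by_cases hP : P (truncate j u)
    · simp [hP, h.1]
    · simp [hP]
  · intro v _ hv
    by_cases h1 : v.1.1 = j ∧ P v
    · rw [if_neg fun h2 => hv ((eq_truncate_iff j u v).2 ⟨h1.1, h2⟩), mul_zero]
    · rw [if_neg h1, zero_mul]

theorem marginal_finest (p : FinestPart K → ℝ) (u : FinestPart K) : marginal p u.1 = p u := by
  rw [marginal, Finset.sum_eq_single_of_mem u (Finset.mem_univ _)]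
  · simp
  · intro u' _ h
    refine if_neg fun h' => h (FinestPart.ext_signs fun i => h' i ?_)
    rw [Fin.le_def]
    have := u.2
    omega

/-- The two nonzero cases of a repartition row exclude each other, since `w` is not a cell of the
step after its own. -/
theorem Aeq_inr_mul (w : CoarsePart K) (v : Part K) (x : ℝ) :
    Aeq K (.inr w) v * x =
      (if v.1.1 = ⟨w.1.1.1.val + 1, w.2⟩ ∧ ∀ i ≤ w.1.1.1, v.1.2 i = w.1.1.2 i then 1 else 0) * x -
        if v = w.1 then x else 0 := by
  simp only [Aeq, Matrix.of_apply, Fin.ext_iff]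
  by_cases hv : v = w.1
  · subst hv
    simp
  · simp [hv]

theorem marginal_mem_feasible {Q : Matrix (Fin K) (Fin K) ℝ} {p : FinestPart K → ℝ}
    (hp : p ∈ stdSimplex ℝ (FinestPart K))
    (hQ : ∀ i j, i < j → agreeMass p i j = (1 + Q i j) / 2) : marginal p ∈ feasible Q := by
  refine ⟨fun v => Finset.sum_nonneg fun u _ => ?_, funext fun r => ?_, ?_⟩
  · split_ifs
    exacts [hp.1 u, le_rfl]
  · rcases r with ⟨⟨i, j⟩, hij⟩ | w
    · rw [bEq, ← hQ i j hij]
      refine (sum_indicator_mul_marginal p j fun v => v.1.2 i = v.1.2 j).trans ?_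
      dsimp only at hij
      simp [truncate, agreeMass, hij.le]
    · rw [bEq, Matrix.mulVec, dotProduct]
      simp_rw [Aeq_inr_mul]
      rw [Finset.sum_sub_distrib, sum_indicator_mul_marginal p _
        fun v => ∀ i ≤ w.1.1.1, v.1.2 i = w.1.1.2 i, Finset.sum_ite_eq' Finset.univ w.1,
        if_pos (Finset.mem_univ _), marginal, sub_eq_zero]
      refine Finset.sum_congr rfl fun u _ => if_congr ?_ rfl rfl
      refine forall₂_congr fun i hi => ?_
      have : i ≤ (⟨w.1.1.1.val + 1, w.2⟩ : Fin K) := by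
        rw [Fin.le_def] at hi ⊢
        dsimp only
        omega
      simp [truncate, this]
  · simp_rw [marginal_finest]
    exact hp.2

/-- The entropy, in bits, of a distribution on the finest intervals. -/
theorem entropy_marginal (p : FinestPart K → ℝ) :
    entropy (marginal p) = -∑ u, p u * Real.logb 2 (p u) := by
  simp_rw [entropy, marginal_finest]

theorem continuous_mul_logb (b : ℝ) : Continuous fun x : ℝ => x * Real.logb b x := by
  simp_rw [Real.logb, ← mul_div_assoc]
  exact Real.continuous_mul_log.div_const _

theorem continuous_entropy : Continuous (entropy : (Part K → ℝ) → ℝ) :=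
  (continuous_finsetSum _ fun v _ => (continuous_mul_logb 2).comp (continuous_apply v.1)).neg

theorem isClosed_feasible (Q : Matrix (Fin K) (Fin K) ℝ) : IsClosed (feasible Q) := by
  have h : feasible Q = (⋂ v, {a | 0 ≤ a v}) ∩
      ({a | (Aeq K).mulVec a = bEq Q} ∩ {a | ∑ v : FinestPart K, a v.1 = 1}) := by
    ext a
    simp [feasible]
  rw [h]
  refine (isClosed_iInter fun v => isClosed_le continuous_const (by fun_prop)).inter
    (IsClosed.inter (isClosed_eq (by fun_prop) continuous_const)
      (isClosed_eq (by fun_prop) continuous_const))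

/-- Only the finest lengths are normalised, so boundedness of the others is passed up through the
repartition rows, with `d` the number of steps to the finest one. A crude bound suffices for
compactness. -/
theorem le_of_mem_feasible {Q : Matrix (Fin K) (Fin K) ℝ} {a : Part K → ℝ} (ha : a ∈ feasible Q)
    (d : ℕ) (v : Part K) (hv : v.1.1.val + 1 + d = K) :
    a v ≤ (Fintype.card (Part K) : ℝ) ^ d := by
  induction d generalizing v with
  | zero =>
    have h := Finset.single_le_sum (f := fun u : FinestPart K => a u.1) (fun u _ => ha.1 u.1)
      (Finset.mem_univ (⟨v, hv⟩ : FinestPart K))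
    simpa [ha.2.2] using h
  | succ d ih =>
    have h := congrFun ha.2.1 (.inr ⟨v, by omega⟩)
    rw [bEq, Matrix.mulVec, dotProduct] at h
    simp_rw [Aeq_inr_mul] at h
    rw [Finset.sum_sub_distrib, Finset.sum_ite_eq' Finset.univ v, if_pos (Finset.mem_univ _),
      sub_eq_zero] at h
    rw [← h, pow_succ']
    refine (Finset.sum_le_card_nsmul _ _ ((Fintype.card (Part K) : ℝ) ^ d) fun v' _ => ?_).trans ?_
    · split_ifs with h'
      · rw [one_mul]
        refine ih v' ?_
        have := congrArg Fin.val h'.1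
        dsimp only at this
        omega
      · simp only [zero_mul]
        positivity
    · simp

theorem isCompact_feasible (Q : Matrix (Fin K) (Fin K) ℝ) : IsCompact (feasible Q) := by
  refine (isCompact_univ_pi fun v : Part K => isCompact_Icc (a := (0 : ℝ))
    (b := (Fintype.card (Part K) : ℝ) ^ (K - (v.1.1.val + 1)))).of_isClosed_subset
    (isClosed_feasible Q) fun a ha v _ => ⟨ha.1 v, le_of_mem_feasible ha _ v ?_⟩
  have := v.1.1.2
  omega

theorem exists_isMaxOn_entropy {Q : Matrix (Fin K) (Fin K) ℝ} (hQ : (feasible Q).Nonempty) :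
    ∃ a ∈ feasible Q, IsMaxOn entropy (feasible Q) a ∧
      sSup (entropy '' feasible Q) = entropy a := by
  obtain ⟨a, ha, hmax⟩ := (isCompact_feasible Q).exists_isMaxOn hQ continuous_entropy.continuousOn
  refine ⟨a, ha, hmax, IsGreatest.csSup_eq ⟨⟨a, ha, rfl⟩, ?_⟩⟩
  rintro _ ⟨b, hb, rfl⟩
  exact hmax hb

theorem entropy_nonneg {Q : Matrix (Fin K) (Fin K) ℝ} {a : Part K → ℝ} (ha : a ∈ feasible Q) :
    0 ≤ entropy a := by
  rw [entropy, neg_nonneg]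
  refine Finset.sum_nonpos fun u _ => mul_nonpos_of_nonneg_of_nonpos (ha.1 _) ?_
  refine Real.logb_nonpos (by norm_num) (ha.1 _) ?_
  have h := Finset.single_le_sum (f := fun u : FinestPart K => a u.1) (fun u _ => ha.1 u.1)
    (Finset.mem_univ u)
  rwa [ha.2.2] at h

/-- The finest interval of the coordinates at which the vectors have the signs `τ`, after the
normalisation of vector `0`. -/
def normalize (hK : 0 < K) (τ : Fin K → Bool) : FinestPart K :=
  ⟨⟨(⟨K - 1, Nat.sub_lt hK one_pos⟩, fun i => τ i == τ ⟨0, hK⟩), fun i hi => by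
    rcases hi with hi | hi
    · have : i = ⟨0, hK⟩ := Fin.ext hi
      simp [this]
    · rw [Fin.lt_def] at hi
      have := i.2
      dsimp only at hi
      omega⟩, Nat.sub_add_cancel hK⟩

theorem normalize_eq_iff (hK : 0 < K) (τ : Fin K → Bool) (i j : Fin K) :
    (normalize hK τ).1.1.2 i = (normalize hK τ).1.1.2 j ↔ τ i = τ j := by
  simp only [normalize]
  cases τ i <;> cases τ j <;> cases τ ⟨0, hK⟩ <;> decide

theorem sum_ite_apply_eq_apply {ι : Type*} [Fintype ι] [DecidableEq ι] (x y : ι) :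
    ∑ τ : ι → Bool, (if τ x = τ y then (1 : ℝ) else 0) =
      2 ^ Fintype.card ι * ((1 + if x = y then 1 else 0) / 2) := by
  have hcard : ∑ τ : ι → Bool, (1 : ℝ) = 2 ^ Fintype.card ι := by simp
  by_cases hxy : x = y
  · subst hxy
    rw [← hcard]
    simp
  · let e : (ι → Bool) ≃ (ι → Bool) :=
      Equiv.piCongrRight fun i => if i = x then Equiv.boolNot else Equiv.refl _
    have h := Equiv.sum_comp e fun τ : ι → Bool => if τ x = τ y then (1 : ℝ) else 0
    have h2 : ∀ τ : ι → Bool, (if e τ x = e τ y then (1 : ℝ) else 0) =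
        1 - if τ x = τ y then 1 else 0 := by
      intro τ
      have : e τ x = !τ x := by simp [e]
      have : e τ y = τ y := by simp [e, Ne.symm hxy]
      simp only [*]
      cases τ x <;> cases τ y <;> simp
    simp_rw [h2] at h
    rw [Finset.sum_sub_distrib, hcard] at h
    rw [if_neg hxy]
    linarith

/-- The distribution of the normalised pattern of uniform signs that are constant on the fibres
of `x`. -/
def uniformSigns (hK : 0 < K) (x : Fin K → Fin K) (u : FinestPart K) : ℝ :=
  (2 ^ K)⁻¹ * ∑ τ : Fin K → Bool, if normalize hK (τ ∘ x) = u then 1 else 0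

theorem uniformSigns_mem_stdSimplex (hK : 0 < K) (x : Fin K → Fin K) :
    uniformSigns hK x ∈ stdSimplex ℝ (FinestPart K) := by
  constructor
  · intro u
    exact mul_nonneg (by positivity) (Finset.sum_nonneg fun τ _ => by split_ifs <;> norm_num)
  · simp_rw [uniformSigns]
    rw [← Finset.mul_sum, Finset.sum_comm]
    simp

theorem agreeMass_uniformSigns (hK : 0 < K) (x : Fin K → Fin K) (i j : Fin K) :
    agreeMass (uniformSigns hK x) i j = (1 + if x i = x j then 1 else 0) / 2 := by
  simp_rw [agreeMass_eq_sum_mul, uniformSigns, mul_left_comm _ ((2 : ℝ) ^ K)⁻¹]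
  rw [← Finset.mul_sum, inv_mul_eq_iff_eq_mul₀ (by positivity)]
  simp_rw [Finset.mul_sum]
  rw [Finset.sum_comm]
  have h := sum_ite_apply_eq_apply (x i) (x j)
  rw [Fintype.card_fin] at h
  simp only [mul_ite, mul_one, mul_zero, Finset.sum_ite_eq, Finset.mem_univ, if_true,
    normalize_eq_iff, Function.comp_apply]
  exact h

/-- Uniform signs that are constant on blocks of size `k l` have overlap matrix `blockOnes (k s) (k
l)`. The weights `q l - q (l + 1)` are positive and telescope to `1`, and agreement is linear in the
distribution, so the mixture realises `Q`. -/
theorem exists_agreeMass_ultMatrix {s : ℕ} {k : ℕ → ℕ} {q : ℕ → ℝ} (hk : IsClusterSeq s k)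
    (hq : IsOverlapSeq s q) :
    ∃ p ∈ stdSimplex ℝ (FinestPart (k s)),
      ∀ i j, agreeMass p i j = (1 + ultMatrix s k q i j) / 2 := by
  have hK : 0 < k s := hk.pos le_rfl
  have hsum : ∑ l ∈ Finset.range (s + 1), (q l - q (l + 1)) = 1 := by
    rw [Finset.sum_range_sub', hq.zero, hq.last, sub_zero]
  let x : ℕ → Fin (k s) → Fin (k s) := fun l a => ⟨a.val / k l, (Nat.div_le_self _ _).trans_lt a.2⟩
  refine ⟨∑ l ∈ Finset.range (s + 1), (q l - q (l + 1)) • uniformSigns hK (x l), ?_, fun i j => ?_⟩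
  · refine (convex_stdSimplex ℝ _).sum_mem (fun l hl => ?_) hsum fun l _ =>
      uniformSigns_mem_stdSimplex hK (x l)
    rw [Finset.mem_range] at hl
    exact (hq.sub_pos (by omega)).le
  · have h : ∀ l, ∑ u : FinestPart (k s), (if u.1.1.2 i = u.1.1.2 j then (1 : ℝ) else 0) *
        ((q l - q (l + 1)) * uniformSigns hK (x l) u) =
        (q l - q (l + 1)) * ((1 + blockOnes (k s) (k l) i j) / 2) := by
      intro l
      simp_rw [mul_left_comm _ (q l - q (l + 1))]
      rw [← Finset.mul_sum, ← agreeMass_eq_sum_mul, agreeMass_uniformSigns]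
      simp [x, blockOnes]
    simp_rw [agreeMass_eq_sum_mul, Finset.sum_apply, Pi.smul_apply, smul_eq_mul, Finset.mul_sum]
    rw [Finset.sum_comm]
    simp_rw [h]
    rw [ultMatrix, Matrix.sum_apply]
    simp only [Matrix.smul_apply, smul_eq_mul]
    refine Eq.trans ?_ (congrArg (fun c : ℝ => (c + _) / 2) hsum)
    rw [← Finset.sum_add_distrib, Finset.sum_div]
    exact Finset.sum_congr rfl fun l _ => by ring

theorem feasible_ultMatrix_nonempty {s : ℕ} {k : ℕ → ℕ} {q : ℕ → ℝ} (hk : IsClusterSeq s k)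
    (hq : IsOverlapSeq s q) : (feasible (ultMatrix s k q)).Nonempty := by
  obtain ⟨p, hp, h⟩ := exists_agreeMass_ultMatrix hk hq
  exact ⟨_, marginal_mem_feasible hp fun i j _ => h i j⟩

theorem continuous_agreeMass (i j : Fin K) :
    Continuous fun p : FinestPart K → ℝ => agreeMass p i j := by
  simp_rw [agreeMass_eq_sum_mul]
  fun_prop

/-- The value of the program is upper semicontinuous in the constraints. Otherwise distributions
with vanishing constraint error and entropy at least `h` would accumulate, in the compact simplex,
at an exactly feasible one of entropy at least `h`. -/
theorem exists_entropy_lt {Q : Matrix (Fin K) (Fin K) ℝ} {h : ℝ}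
    (hh : sSup (entropy '' feasible Q) < h) :
    ∃ ε > 0, ∀ p ∈ stdSimplex ℝ (FinestPart K),
      (∀ i j, |agreeMass p i j - (1 + Q i j) / 2| ≤ ε) → -∑ u, p u * Real.logb 2 (p u) < h := by
  by_contra! hcon
  choose p hp hpQ hph using fun n : ℕ => hcon (1 / ((n : ℝ) + 1)) (by positivity)
  obtain ⟨p₀, hp₀, φ, hφ, hlim⟩ := (isCompact_stdSimplex ℝ (FinestPart K)).tendsto_subseq hp
  have hQ₀ : ∀ i j, agreeMass p₀ i j = (1 + Q i j) / 2 := by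
    intro i j
    refine tendsto_nhds_unique (((continuous_agreeMass i j).tendsto p₀).comp hlim) ?_
    rw [tendsto_iff_dist_tendsto_zero]
    exact squeeze_zero (fun _ => dist_nonneg) (fun n => hpQ (φ n) i j)
      (tendsto_one_div_add_atTop_nhds_zero_nat.comp hφ.tendsto_atTop)
  have hf := marginal_mem_feasible hp₀ fun i j _ => hQ₀ i j
  obtain ⟨a, -, hmax, hsup⟩ := exists_isMaxOn_entropy ⟨_, hf⟩
  have h1 : entropy (marginal p₀) ≤ entropy a := hmax hf
  have hcont : Continuous fun p : FinestPart K → ℝ => -∑ u, p u * Real.logb 2 (p u) :=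
    (continuous_finsetSum _ fun u _ => (continuous_mul_logb 2).comp (continuous_apply u)).neg
  have h2 : h ≤ -∑ u, p₀ u * Real.logb 2 (p₀ u) :=
    ge_of_tendsto ((hcont.tendsto p₀).comp hlim) (Eventually.of_forall fun n => hph (φ n))
  rw [← entropy_marginal] at h2
  linarith

end Partition

/-! ### The method of types -/

section Types

variable {V : Type*} [Fintype V] [DecidableEq V] {n : ℕ}

/-- The empirical distribution of a word. -/
def empirical (ω : Fin n → V) (v : V) : ℝ :=
  ((Finset.univ.filter fun r => ω r = v).card : ℝ) / n

theorem sum_mul_empirical (f : V → ℝ) (ω : Fin n → V) :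
    ∑ v, f v * empirical ω v = (∑ r, f (ω r)) / n := by
  simp_rw [empirical, mul_div_assoc', ← Finset.sum_div]
  congr 1
  rw [← Finset.sum_fiberwise' Finset.univ ω f]
  exact Finset.sum_congr rfl fun v _ => by rw [Finset.sum_const, nsmul_eq_mul, mul_comm]

theorem empirical_mem_stdSimplex (hn : 0 < n) (ω : Fin n → V) :
    empirical ω ∈ stdSimplex ℝ V := by
  refine ⟨fun v => by unfold empirical; positivity, ?_⟩
  have h := sum_mul_empirical (fun _ => 1) ω
  simp only [one_mul] at h
  rw [h]
  have : (n : ℝ) ≠ 0 := Nat.cast_ne_zero.2 hn.ne'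
  simp [this]

/-- Under independent letters with law `p`, every word of type `p` has the same probability, the
inverse of the right-hand side, and the total is at most `1`. -/
theorem card_empirical_eq_le (hn : 0 < n) (p : V → ℝ) :
    ((Finset.univ.filter fun ω : Fin n → V => empirical ω = p).card : ℝ) ≤
      Real.exp (n * -∑ v, p v * Real.log (p v)) := by
  rcases (Finset.univ.filter fun ω : Fin n → V => empirical ω = p).eq_empty_or_nonempty with h | h
  · rw [h]
    simp [Real.exp_nonneg]
  obtain ⟨ω₀, hω₀⟩ := h
  have hp : p ∈ stdSimplex ℝ V := (Finset.mem_filter.1 hω₀).2 ▸ empirical_mem_stdSimplex hn ω₀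
  have hn' : (n : ℝ) ≠ 0 := Nat.cast_ne_zero.2 hn.ne'
  have hprod : ∀ ω : Fin n → V, empirical ω = p →
      ∏ r, p (ω r) = Real.exp (n * ∑ v, p v * Real.log (p v)) := by
    rintro ω rfl
    -- Letters that occur have positive frequency, so the logarithm can be inverted along the word.
    have hpos : ∀ r, 0 < empirical ω (ω r) := fun r => by
      refine div_pos (Nat.cast_pos.2 (Finset.card_pos.2 ⟨r, by simp⟩)) (Nat.cast_pos.2 hn)
    simp_rw [mul_comm (empirical ω _)]
    rw [sum_mul_empirical, mul_div_cancel₀ _ hn', Real.exp_sum]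
    exact Finset.prod_congr rfl fun r _ => (Real.exp_log (hpos r)).symm
  have htotal : ∑ ω : Fin n → V, ∏ r, p (ω r) = 1 := by
    have h := Finset.prod_univ_sum (fun _ : Fin n => (Finset.univ : Finset V)) fun _ v => p v
    rw [Fintype.piFinset_univ] at h
    rw [← h, hp.2]
    simp
  have hle : ∑ ω ∈ Finset.univ.filter fun ω : Fin n → V => empirical ω = p, ∏ r, p (ω r) ≤ 1 :=
    htotal ▸ Finset.sum_le_univ_sum_of_nonneg fun ω => Finset.prod_nonneg fun r _ => hp.1 _
  rw [Finset.sum_congr rfl fun ω hω => hprod ω (Finset.mem_filter.1 hω).2, Finset.sum_const,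
    nsmul_eq_mul] at hle
  rw [mul_neg, Real.exp_neg, ← one_div, le_div_iff₀ (Real.exp_pos _)]
  exact hle

/-- The number of words of length `n` whose empirical distributions have entropy at most `H`. -/
theorem card_le_of_entropy_le (hn : 0 < n) (S : Finset (Fin n → V)) {H : ℝ}
    (hS : ∀ ω ∈ S, -∑ v, empirical ω v * Real.log (empirical ω v) ≤ H) :
    (S.card : ℝ) ≤ ((n : ℝ) + 1) ^ Fintype.card V * Real.exp (n * H) := by
  -- Words are sorted by their letter counts; there are at most `(n + 1) ^ |V|` count vectors.
  let count : (Fin n → V) → V → Fin (n + 1) := fun ω v =>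
    ⟨(Finset.univ.filter fun r => ω r = v).card,
      Nat.lt_succ_of_le ((Finset.card_le_univ _).trans_eq (Fintype.card_fin n))⟩
  have hfib : ∀ c ∈ S.image count,
      ((S.filter fun ω => count ω = c).card : ℝ) ≤ Real.exp (n * H) := by
    intro c hc
    obtain ⟨ω₀, hω₀, rfl⟩ := Finset.mem_image.1 hc
    have hsub : (S.filter fun ω => count ω = count ω₀) ⊆
        Finset.univ.filter fun ω => empirical ω = empirical ω₀ := by
      intro ω hω
      rw [Finset.mem_filter] at hω ⊢
      refine ⟨Finset.mem_univ _, funext fun v => ?_⟩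
      have := congrArg Fin.val (congrFun hω.2 v)
      simp only [count] at this
      rw [empirical, empirical, this]
    refine (Nat.cast_le.2 (Finset.card_le_card hsub)).trans ((card_empirical_eq_le hn _).trans ?_)
    exact Real.exp_le_exp.2 (mul_le_mul_of_nonneg_left (hS ω₀ hω₀) (Nat.cast_nonneg n))
  rw [Finset.card_eq_sum_card_image count S, Nat.cast_sum]
  refine (Finset.sum_le_card_nsmul _ _ _ hfib).trans ?_
  rw [nsmul_eq_mul]
  refine mul_le_mul_of_nonneg_right ?_ (Real.exp_nonneg _)
  have h := Finset.card_le_univ (S.image count)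
  rw [Fintype.card_fun, Fintype.card_fin] at h
  exact_mod_cast h

end Types

/-! ### The first moment bound and the critical density -/

section FirstMoment

variable {K : ℕ}

/-- The real sign with a given truth value. -/
def signVal (b : Bool) : ℝ := if b then 1 else -1

theorem signVal_mul_signVal (b c : Bool) :
    signVal b * signVal c = 2 * (if b = c then 1 else 0) - 1 := by
  cases b <;> cases c <;> norm_num [signVal]

/-- The matrix whose columns have the normalised signs `ω` and whose column `0` has the
signs `θ`. -/
def signMatrix {n : ℕ} (θ : Fin n → Bool) (ω : Fin n → FinestPart K) :
    Matrix (Fin n) (Fin K) ℝ :=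
  Matrix.of fun r a => signVal (θ r) * signVal ((ω r).1.1.2 a) / √n

theorem exists_signMatrix_eq (hK : 0 < K) {n : ℕ} {X : Matrix (Fin n) (Fin K) ℝ}
    (hX : ColumnsInCube X) : ∃ θ ω, signMatrix θ ω = X := by
  classical
  let τ : Fin n → Fin K → Bool := fun r a => decide (X r a = 1 / √(n : ℝ))
  refine ⟨fun r => τ r ⟨0, hK⟩, fun r => normalize hK (τ r), ?_⟩
  ext r a
  have h : X r a = signVal (τ r a) / √n := by
    by_cases h : X r a = 1 / √(n : ℝ)
    · simp [τ, h, signVal]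
    · rw [show τ r a = false from decide_eq_false h, (hX r a).resolve_left h]
      simp [signVal, neg_div]
  rw [h, signMatrix, Matrix.of_apply]
  congr 1
  simp only [normalize]
  cases τ r a <;> cases τ r ⟨0, hK⟩ <;> norm_num [signVal]

/-- The signs `θ` square to `1`, so the overlaps depend only on the normalised word. -/
theorem transpose_mul_signMatrix {n : ℕ} (hn : 0 < n) (θ : Fin n → Bool)
    (ω : Fin n → FinestPart K) (a b : Fin K) :
    ((signMatrix θ ω).transpose * signMatrix θ ω) a b =
      2 * agreeMass (empirical ω) a b - 1 := by
  have hn' : (0 : ℝ) < n := Nat.cast_pos.2 hn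
  have h : ∀ r, signMatrix θ ω r a * signMatrix θ ω r b =
      (2 * (if (ω r).1.1.2 a = (ω r).1.1.2 b then 1 else 0) - 1) / n := by
    intro r
    have h1 : signVal (θ r) * signVal (θ r) = 1 := by rw [signVal_mul_signVal]; norm_num
    rw [signMatrix, Matrix.of_apply, Matrix.of_apply, div_mul_div_comm,
      Real.mul_self_sqrt hn'.le, mul_mul_mul_comm, h1, one_mul, signVal_mul_signVal]
  rw [Matrix.mul_apply]
  simp_rw [Matrix.transpose_apply, h]
  rw [agreeMass_eq_sum_mul,
    sum_mul_empirical (fun u : FinestPart K => if u.1.1.2 a = u.1.1.2 b then (1 : ℝ) else 0),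
    ← Finset.sum_div, Finset.sum_sub_distrib, ← Finset.mul_sum]
  simp only [Finset.sum_const, Finset.card_univ, Fintype.card_fin, nsmul_eq_mul, mul_one]
  field_simp

theorem posSemidef_transpose_mul_self {n : ℕ} (X : Matrix (Fin n) (Fin K) ℝ) :
    (X.transpose * X).PosSemidef := by
  simpa using Matrix.posSemidef_conjTranspose_mul_self X

/-- The first moment bound for the number of tuples of solutions with overlap matrix near `Q`. -/
theorem gaussianMatrix_tupleEvent_le (hK : 0 < K) (κ : ℝ) {Q : Matrix (Fin K) (Fin K) ℝ}
    {ε H p : ℝ} (hp0 : 0 ≤ p)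
    (hε : ∀ p ∈ stdSimplex ℝ (FinestPart K),
      (∀ i j, |agreeMass p i j - (1 + Q i j) / 2| ≤ ε) → -∑ u, p u * Real.logb 2 (p u) ≤ H)
    (hp : ∀ R : Matrix (Fin K) (Fin K) ℝ, R.PosSemidef → (∀ a b, |R a b - Q a b| ≤ ε) →
      boxProb κ R ≤ p) {m n : ℕ} (hn : 0 < n) :
    gaussianMatrix m n (tupleEvent κ m n Q ε) ≤ ENNReal.ofReal
      (2 ^ n * (((n : ℝ) + 1) ^ Fintype.card (FinestPart K) * Real.exp (n * (H * Real.log 2))) *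
        p ^ m) := by
  classical
  let S : Finset (Fin n → FinestPart K) := Finset.univ.filter fun ω =>
    ∀ i j, |agreeMass (empirical ω) i j - (1 + Q i j) / 2| ≤ ε
  let W : Finset ((Fin n → Bool) × (Fin n → FinestPart K)) :=
    Finset.univ.filter fun x => signMatrix x.1 x.2 ∈ overlapSet n Q ε
  have hagree : ∀ θ ω, signMatrix θ ω ∈ overlapSet n Q ε →
      ∀ i j, |agreeMass (empirical ω) i j - (1 + Q i j) / 2| ≤ ε := by
    intro θ ω h i j
    have h2 := h.2 i j
    rw [transpose_mul_signMatrix hn] at h2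
    have : agreeMass (empirical ω) i j - (1 + Q i j) / 2 =
        (2 * agreeMass (empirical ω) i j - 1 - Q i j) / 2 := by ring
    rw [this, abs_div, abs_two]
    linarith [abs_nonneg (2 * agreeMass (empirical ω) i j - 1 - Q i j)]
  -- The signs of column `0` are unconstrained; they give the extra bit in `hFactor`.
  have hW : (W.card : ℝ) ≤ 2 ^ n * S.card := by
    have h : W ⊆ Finset.univ ×ˢ S := fun x hx => Finset.mem_product.2 ⟨Finset.mem_univ _,
      Finset.mem_filter.2 ⟨Finset.mem_univ _, hagree x.1 x.2 (Finset.mem_filter.1 hx).2⟩⟩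
    have h2 := Finset.card_le_card h
    rw [Finset.card_product, Finset.card_univ, Fintype.card_fun, Fintype.card_bool,
      Fintype.card_fin] at h2
    exact_mod_cast h2
  have hS : (S.card : ℝ) ≤ ((n : ℝ) + 1) ^ Fintype.card (FinestPart K) *
      Real.exp (n * (H * Real.log 2)) := by
    refine card_le_of_entropy_le hn S fun ω hω => ?_
    have h := hε _ (empirical_mem_stdSimplex hn ω) (Finset.mem_filter.1 hω).2
    have hlog : 0 < Real.log 2 := Real.log_pos (by norm_num)
    simp_rw [Real.logb, ← mul_div_assoc, ← Finset.sum_div] at h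
    rwa [← neg_div, div_le_iff₀ hlog] at h
  have hsub : tupleEvent κ m n Q ε ⊆
      ⋃ x ∈ W, {G | ∀ r a, |(Matrix.of G * signMatrix x.1 x.2) r a| ≤ κ} := by
    rintro G ⟨X, hX, hG⟩
    obtain ⟨θ, ω, rfl⟩ := exists_signMatrix_eq hK hX.1
    exact Set.mem_biUnion (x := (θ, ω)) (Finset.mem_filter.2 ⟨Finset.mem_univ _, hX⟩) hG
  calc gaussianMatrix m n (tupleEvent κ m n Q ε)
      ≤ ∑ x ∈ W, gaussianMatrix m n {G | ∀ r a, |(Matrix.of G * signMatrix x.1 x.2) r a| ≤ κ} :=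
        (measure_mono hsub).trans (measure_biUnion_finset_le _ _)
    _ ≤ W.card • ENNReal.ofReal (p ^ m) := by
        refine Finset.sum_le_card_nsmul _ _ _ fun x hx => ?_
        rw [gaussianMatrix_forall_abs_le]
        exact ENNReal.ofReal_le_ofReal (pow_le_pow_left₀ measureReal_nonneg
          (hp _ (posSemidef_transpose_mul_self _) (Finset.mem_filter.1 hx).2.2) m)
    _ = ENNReal.ofReal (W.card * p ^ m) := by
        rw [ENNReal.ofReal_mul (Nat.cast_nonneg _), ENNReal.ofReal_natCast, nsmul_eq_mul]
    _ ≤ _ := ENNReal.ofReal_le_ofReal (mul_le_mul_of_nonneg_right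
        (hW.trans (mul_le_mul_of_nonneg_left hS (by positivity))) (pow_nonneg hp0 m))

/-- The expression is `exp (n * x n)` with `x n` tending to `c + α * log p < 0`; the polynomial
factor contributes only `O(log n / n)` to `x n`. -/
theorem tendsto_firstMoment {α c p : ℝ} (hp : 0 < p) (hneg : c + α * Real.log p < 0) (C : ℕ)
    {m : ℕ → ℕ} (hm : Tendsto (fun n => (m n : ℝ) / n) atTop (𝓝 α)) :
    Tendsto (fun n : ℕ => ((n : ℝ) + 1) ^ C * Real.exp (n * c) * p ^ m n) atTop (𝓝 0) := by
  have hlog : Tendsto (fun n : ℕ => Real.log ((n : ℝ) + 1) / n) atTop (𝓝 0) := by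
    have h1 : Tendsto (fun x : ℝ => Real.log (x + 1) / x) atTop (𝓝 0) := by
      have h2 : (fun x : ℝ => Real.log (x + 1)) =o[atTop] fun x : ℝ => x := by
        have h3 := Real.isLittleO_log_id_atTop.comp_tendsto
          (tendsto_atTop_add_const_right atTop (1 : ℝ) tendsto_id)
        refine h3.trans_isBigO (Asymptotics.IsBigO.of_bound 2 ?_)
        filter_upwards [eventually_ge_atTop (1 : ℝ)] with x hx
        simp only [Function.comp_apply, id_eq, Real.norm_eq_abs]
        rw [abs_of_nonneg (by linarith), abs_of_nonneg (by linarith)]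
        linarith
      exact h2.tendsto_div_nhds_zero
    exact h1.comp tendsto_natCast_atTop_atTop
  have hx : Tendsto (fun n : ℕ => C * (Real.log ((n : ℝ) + 1) / n) + c + m n / n * Real.log p)
      atTop (𝓝 (c + α * Real.log p)) := by
    have h := ((hlog.const_mul (C : ℝ)).add_const c).add (hm.mul_const (Real.log p))
    simpa using h
  have hexp := Real.tendsto_exp_atBot.comp
    ((tendsto_natCast_atTop_atTop (R := ℝ)).atTop_mul_neg hneg hx)
  refine hexp.congr' ?_
  filter_upwards [eventually_gt_atTop 0] with n hn
  have hn' : (n : ℝ) ≠ 0 := Nat.cast_ne_zero.2 hn.ne'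
  have hn1 : (0 : ℝ) < n + 1 := by positivity
  rw [Function.comp_apply, ← Real.exp_log (pow_pos hn1 C), ← Real.exp_log (pow_pos hp (m n)),
    ← Real.exp_add, ← Real.exp_add, Real.log_pow, Real.log_pow]
  congr 1
  field_simp

theorem exhibitsUltOGP_of_lt {s : ℕ} {k : ℕ → ℕ} {q : ℕ → ℝ} (hk : IsClusterSeq s k)
    (hq : IsOverlapSeq s q) {κ α : ℝ}
    (hp : boxProb κ (ultMatrix s k q) ∈ Set.Ioo (0 : ℝ) 1)
    (hlt : hFactor s k q * Real.log 2 + α * Real.log (boxProb κ (ultMatrix s k q)) < 0) :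
    ExhibitsUltOGP s κ α := by
  set P := boxProb κ (ultMatrix s k q) with hP
  have hlog2 : 0 < Real.log 2 := Real.log_pos (by norm_num)
  -- The strict inequality leaves room to enlarge first `P` and then `hFactor`; this slack is what
  -- pays for a positive tolerance.
  obtain ⟨p, hpP, hp1⟩ : ∃ p > P, hFactor s k q * Real.log 2 + α * Real.log p < 0 := by
    have hc : ContinuousAt (fun p => hFactor s k q * Real.log 2 + α * Real.log p) P :=
      continuousAt_const.add (continuousAt_const.mul (Real.continuousAt_log hp.1.ne'))
    have h1 : ∀ᶠ p in 𝓝[>] P, hFactor s k q * Real.log 2 + α * Real.log p < 0 :=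
      (hc.eventually_lt_const hlt).filter_mono nhdsWithin_le_nhds
    obtain ⟨p, h, h'⟩ := (h1.and self_mem_nhdsWithin).exists
    exact ⟨p, h', h⟩
  obtain ⟨h, hh, hh1⟩ : ∃ h > hFactor s k q, h * Real.log 2 + α * Real.log p < 0 := by
    have hc : ContinuousAt (fun h => h * Real.log 2 + α * Real.log p) (hFactor s k q) := by
      fun_prop
    have h1 : ∀ᶠ h in 𝓝[>] hFactor s k q, h * Real.log 2 + α * Real.log p < 0 :=
      (hc.eventually_lt_const hp1).filter_mono nhdsWithin_le_nhds
    obtain ⟨h, h2, h'⟩ := (h1.and self_mem_nhdsWithin).exists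
    exact ⟨h, h', h2⟩
  have hp0 : 0 < p := hp.1.trans hpP
  obtain ⟨ε₁, hε₁, h₁⟩ := exists_boxProb_lt κ (posSemidef_ultMatrix hk hq) hpP
  -- The `1` subtracted is the bit for the signs of column `0`, counted separately as `2 ^ n`.
  obtain ⟨ε₂, hε₂, h₂⟩ := exists_entropy_lt (Q := ultMatrix s k q) (h := h - 1)
    (by rw [gt_iff_lt, hFactor] at hh; linarith)
  refine ⟨k, q, hk, hq, min ε₁ ε₂, lt_min hε₁ hε₂, fun m hm => ?_⟩
  have hlim := tendsto_firstMoment hp0 hh1 (Fintype.card (FinestPart (k s))) hm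
  have hlim' := ENNReal.tendsto_ofReal hlim
  rw [ENNReal.ofReal_zero] at hlim'
  refine tendsto_of_tendsto_of_tendsto_of_le_of_le' tendsto_const_nhds hlim'
    (Eventually.of_forall fun _ => zero_le) ?_
  filter_upwards [eventually_gt_atTop 0] with n hn
  refine (gaussianMatrix_tupleEvent_le (hk.pos le_rfl) κ hp0.le (H := h - 1)
    (fun p hp hQ => (h₂ p hp fun i j => (hQ i j).trans (min_le_right _ _)).le)
    (fun R hR hQ => (h₁ R hR fun i j => (hQ i j).trans (min_le_left _ _)).le) hn).trans_eq ?_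
  have h2n : (2 : ℝ) ^ n = Real.exp (n * Real.log 2) := by
    rw [mul_comm, Real.exp_mul, Real.exp_log (by norm_num), Real.rpow_natCast]
  have hsplit : (n : ℝ) * (h * Real.log 2) =
      n * Real.log 2 + n * ((h - 1) * Real.log 2) := by ring
  rw [hsplit, Real.exp_add, h2n]
  congr 1
  ring

/-- Every density above the threshold exhibits the gap property. Positivity of `hFactor` makes the
threshold positive, as the infimum ranges over positive densities only. -/
theorem alphaUlt_le {s : ℕ} {k : ℕ → ℕ} {q : ℕ → ℝ} (hk : IsClusterSeq s k)
    (hq : IsOverlapSeq s q) {κ : ℝ} (hh : 0 < hFactor s k q)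
    (hp : boxProb κ (ultMatrix s k q) ∈ Set.Ioo (0 : ℝ) 1) :
    alphaUlt s κ ≤ ((-(hFactor s k q * Real.log 2 /
      Real.log (boxProb κ (ultMatrix s k q))) : ℝ) : EReal) := by
  have hlog2 : 0 < Real.log 2 := Real.log_pos (by norm_num)
  have hlogp : Real.log (boxProb κ (ultMatrix s k q)) < 0 := Real.log_neg hp.1 hp.2
  refine EReal.le_of_forall_lt_iff_le.1 fun α hα => ?_
  rw [EReal.coe_lt_coe_iff] at hα
  have hα0 : 0 < α := lt_trans
    (neg_pos.2 (div_neg_of_pos_of_neg (mul_pos hh hlog2) hlogp)) hα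
  refine iInf₂_le α ⟨hα0, exhibitsUltOGP_of_lt hk hq hp ?_⟩
  rw [neg_lt, lt_div_iff_of_neg hlogp] at hα
  linarith

end FirstMoment

end SBP

end

theorem theorem1 (κ : ℝ) (hκ : 0 < κ) (s : ℕ) (hs : 1 ≤ s) (k : ℕ → ℕ)
    (hk : SBP.IsClusterSeq s k) :
    -- the program and the nested integral are what they are meant to be, without junk values
    (∀ q : ℕ → ℝ, SBP.IsOverlapSeq s q →
      (∃ a ∈ SBP.feasible (SBP.ultMatrix s k q),
        IsMaxOn SBP.entropy (SBP.feasible (SBP.ultMatrix s k q)) a ∧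
          SBP.hFactor s k q = 1 + SBP.entropy a) ∧
      SBP.pFactor κ s k q = SBP.boxProb κ (SBP.ultMatrix s k q) ∧
      SBP.pFactor κ s k q ∈ Set.Ioo (0 : ℝ) 1) ∧
    -- the bound
    SBP.alphaUlt s κ ≤ SBP.alphaUltBar s κ k := by
  have hbox (q : ℕ → ℝ) (hq : SBP.IsOverlapSeq s q) := SBP.pFactor_eq_boxProb hs hk hq hκ
  have hmem (q : ℕ → ℝ) (hq : SBP.IsOverlapSeq s q) := SBP.boxProb_ultMatrix_mem_Ioo hk hq hκ
  have hmax (q : ℕ → ℝ) (hq : SBP.IsOverlapSeq s q) :=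
    SBP.exists_isMaxOn_entropy (SBP.feasible_ultMatrix_nonempty hk hq)
  refine ⟨fun q hq => ⟨?_, hbox q hq, hbox q hq ▸ hmem q hq⟩, le_iInf₂ fun q hq => ?_⟩
  · obtain ⟨a, ha, hm, hsup⟩ := hmax q hq
    exact ⟨a, ha, hm, by rw [SBP.hFactor, hsup]⟩
  · obtain ⟨a, ha, -, hsup⟩ := hmax q hq
    rw [hbox q hq]
    refine SBP.alphaUlt_le hk hq ?_ (hmem q hq)
    rw [SBP.hFactor, hsup]
    linarith [SBP.entropy_nonneg ha]
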